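/- Let $\mathsf{Seq}$ be the first-order theory in the language $\{e,\vdash,\circ\}$ ($e$ a constant, $\vdash$ and $\circ$ binary function symbols; we write $xy$ for $x\circ y$) with the axioms (1) $x\vdash y\neq e$; (2) $x_1\vdash x_2=y_1\vdash y_2\to x_1=y_1\wedge x_2=y_2$; (3) $xe=x$; (4) $x(y\vdash z)=(xy)\vdash z$; (5) $x=e\vee\exists y z\,[x=y\vdash z]$. A class is a formula with one free variable. We work in $\mathsf{Seq}$ (that is, in an arbitrary model of it) and use the following classes and relations. **The class $\mathcal J$.** Let $A=\{z : ez=z\wedge\forall xy\,[x(yz)=(xy)z]\}$ and $v\sqsubseteq_A w:\Leftrightarrow\exists t\in A\,[w=vt]$. Let $\mathcal J$ be the class of all $w$ such that for every $v\sqsubseteq_A w$, all $x,z$ and all $y\in A$: if $xy=zv$, then there is $u\in A$ with ($x=zu$ and $uy=v$) or ($z=xu$ and $uv=y$). Let $x\preceq y:\Leftrightarrow\exists z\in\mathcal J\,[y=xz]$, and $x\prec y:\Leftrightarrow x\preceq y\wedge x\ne y$. **The class $\mathsf N$.** Let $0:=e$, $\mathrm Sx:=x\vdash e$, $1:=\mathrm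 S0$, $x+y:=xy$. Let $I$ be the class of all $w\in\mathcal J$ such that for all $x\preceq w$: (1) $\{u:u\preceq x\}$ is totally ordered by $\preceq$; (2) $x=0$ or $x=\mathrm Sy$ for some $y$; (3) $u\prec x$ implies $\mathrm Su\preceq x$; (4) if $y\in\mathcal J$ and $\mathrm Su\preceq y$ for all $u\prec y$, then $x\preceq y$ or $y\preceq x$; (5) $\mathrm S(u+x)=\mathrm Su+x$ for all $u\in\mathcal J$; (6) for all $u,v\in\mathcal J$, $u+x=v+x$ implies $u=v$. Let $J=\{w\in I:\forall x\preceq w\,\forall u\in I\,[u+x=x+u]\}$ and $\mathsf N=\{x\in J:\forall y\in J\,[y+x\in J]\}$. Let $x\le y:\Leftrightarrow\exists z\in\mathsf N\,[x+z=y]$ and $x<y:\Leftrightarrow x\le y\wedge x\neq y$. For $x,y\in\mathsf N$ with $y\le x$, $x\dot- y$ is the $z\in\mathsf N$ with $y+z=x$; in all other cases $x\dot- y:=0$. **Indexed sequences.** Write $(k,u)$ for $k\vdash u$. We write $f:[m,n]\to\mathcal J$, and call $f$ an indexed sequence, if $f\in\mathcal J$, $m,n\in\mathsf N$, $m\le n$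 and (1) for all $m\le k\le n$ there are $u,s,t\in\mathcal J$ with $f=(s\vdash(k,u))t$; (2) if $f=(s\vdash w)t$ with $s,t,w\in\mathcal J$, then $w=(k,u)$ for some $m\le k\le n$ and $u\in\mathcal J$; (3) if $f=(s\vdash(k,u))t$ and $s\neq e$ (for any $s,t,k,u$), then $m<k$ and there are $\ell,v,s_0\in\mathcal J$ with $k=\mathrm S\ell$ and $s=s_0\vdash(\ell,v)$; (4) if $f=(s\vdash(k,u))t$ (for any $s,t,k,u$), then there are no $k'\in\mathsf N$ with $k\le k'$ and $u',s_0,t_0\in\mathcal J$ with $s=(s_0\vdash(k',u'))t_0$. For $m\le k\le n$, $f(k)$ is then the unique $u\in\mathcal J$ with $f=(s\vdash(k,u))t$ for some $s,t\in\mathcal J$. **Theorem.** There is a class $\mathsf N^\star$ (a single formula without parameters) such that $\mathsf{Seq}$ proves: $\mathsf N^\star\subseteq\mathsf N$, $\mathsf N^\star$ contains $0$, is closed under $\mathrm S$ and $+$ and is downward closed under $\le$, and the following hold. - **Constants.** For all $x\in\mathcal J$ and $n\in\mathsf N^\star$ there is a unique $\frac{x}{[0,n]}:[0,n]\to\mathcal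 J$ with value $x$ at every $0\le j\le n$. - **Shifts.** For all $k,n\in\mathsf N^\star$ and $f:[0,n]\to\mathcal J$ there is a unique $f^0_k:[k,k+n]\to\mathcal J$ with $f^0_k(k+j)=f(j)$ for all $0\le j\le n$. - **Sums and differences.** For all $n\in\mathsf N^\star$ and $f,g:[0,n]\to\mathcal J$ there are unique $f\oplus g,\ f\ominus g:[0,n]\to\mathcal J$ with $(f\oplus g)(j)=f(j)+g(j)$ and $(f\ominus g)(j)=f(j)\dot- g(j)$ for all $0\le j\le n$. - **Concatenation.** For all $n,m\in\mathsf N^\star$, $f:[0,n]\to\mathcal J$ and $g:[0,m]\to\mathcal J$ there is a unique $f^\frown g:[0,n+m+1]\to\mathcal J$ such that $f^\frown g=f\circ g^0_{n+1}$, $(f^\frown g)(j)=f(j)$ for $0\le j\le n$, and $(f^\frown g)(j)=g(j\dot-(n+1))$ for $n+1\le j\le n+m+1$. - **Splitting.** For all $n\in\mathsf N^\star$, $0\le k<n$ and $f:[0,n]\to\mathcal J$ there is a unique pair $g:[0,k]\to\mathcal J$, $h:[0,n\dot-(k+1)]\to\mathcal J$ with $f=g^\frown h$. - **Associativity.** For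 all $n,m,k\in\mathsf N^\star$, $f:[0,n]\to\mathcal J$, $g:[0,m]\to\mathcal J$, $h:[0,k]\to\mathcal J$: $(f^\frown g)^\frown h=f^\frown(g^\frown h)$. - **Editor axiom.** For all $n,m,k,\ell\in\mathsf N^\star$ and $f:[0,n]\to\mathcal J$, $g:[0,m]\to\mathcal J$, $p:[0,k]\to\mathcal J$, $q:[0,\ell]\to\mathcal J$ with $f^\frown g=p^\frown q$, one of the following holds: $f=p$ and $g=q$; or there are a unique $r\in\mathsf N^\star$ and a unique $h:[0,r]\to\mathcal J$ with $f=p^\frown h$ and $h^\frown g=q$; or there are a unique $r\in\mathsf N^\star$ and a unique $h:[0,r]\to\mathcal J$ with $p=f^\frown h$ and $h^\frown q=g$. -/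

import Mathlib

open FirstOrder

/-- Function symbols: the constant `e`, the binary symbol `⊢` (append one element)
and the binary symbol `∘` (concatenate). -/
inductive SeqFunc : ℕ → Type
  | e : SeqFunc 0
  | app : SeqFunc 2
  | cat : SeqFunc 2

/-- The first-order language `{e, ⊢, ∘}`. -/
def SeqLang : FirstOrder.Language.{0, 0} := ⟨SeqFunc, fun _ => Empty⟩

namespace SeqTh

section Axioms

variable {α : Type}

/-- The term `e`. -/
def eT : SeqLang.Term α := FirstOrder.Language.Term.func (L := SeqLang) SeqFunc.e ![]

/-- The term `s ⊢ t`. -/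
def appT (s t : SeqLang.Term α) : SeqLang.Term α :=
  FirstOrder.Language.Term.func (L := SeqLang) SeqFunc.app ![s, t]

/-- The term `s ∘ t`. -/
def catT (s t : SeqLang.Term α) : SeqLang.Term α :=
  FirstOrder.Language.Term.func (L := SeqLang) SeqFunc.cat ![s, t]

/-- `∀ x y, x ⊢ y ≠ e`. -/
def ax1 : SeqLang.Sentence := ∀' ∀' ∼(appT (&0) (&1) =' eT)

/-- `∀ x₁ x₂ y₁ y₂, x₁ ⊢ x₂ = y₁ ⊢ y₂ → x₁ = y₁ ∧ x₂ = y₂`. -/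
def ax2 : SeqLang.Sentence :=
  ∀' ∀' ∀' ∀' ((appT (&0) (&1) =' appT (&2) (&3)) ⟹ (((&0) =' (&2)) ⊓ ((&1) =' (&3))))

/-- `∀ x, x ∘ e = x`. -/
def ax3 : SeqLang.Sentence := ∀' (catT (&0) eT =' (&0))

/-- `∀ x y z, x ∘ (y ⊢ z) = (x ∘ y) ⊢ z`. -/
def ax4 : SeqLang.Sentence :=
  ∀' ∀' ∀' (catT (&0) (appT (&1) (&2)) =' appT (catT (&0) (&1)) (&2))

/-- `∀ x, x = e ∨ ∃ y z, x = y ⊢ z`. -/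
def ax5 : SeqLang.Sentence :=
  ∀' (((&0) =' eT) ⊔ ∃' ∃' ((&0) =' appT (&1) (&2)))

end Axioms

/-- The theory `Seq`. -/
def Seq : SeqLang.Theory := {ax1, ax2, ax3, ax4, ax5}

section Semantics

variable {M : Type*} [SeqLang.Structure M]

/-- The empty sequence `e`. -/
def nil : M := FirstOrder.Language.Structure.funMap (L := SeqLang) SeqFunc.e ![]

/-- `x ⊢ y`. -/
def app (x y : M) : M := FirstOrder.Language.Structure.funMap (L := SeqLang) SeqFunc.app ![x, y]

/-- `x ∘ y`. -/
def cat (x y : M) : M := FirstOrder.Language.Structure.funMap (L := SeqLang) SeqFunc.cat ![x, y]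

/-- Membership in the class given by a formula with one free variable (no parameters). -/
def Mem (φ : SeqLang.Formula (Fin 1)) (x : M) : Prop := φ.Realize fun _ => x

/-! ### The class `J` on which concatenation is well behaved -/

/-- The class of elements that are fixed by `e ∘ ·` and associate in the last position. -/
def ClassA (z : M) : Prop :=
  cat nil z = z ∧ ∀ x y : M, cat x (cat y z) = cat (cat x y) z

/-- `v ⊑_A w`. -/
def SubA (v w : M) : Prop := ∃ t : M, ClassA t ∧ w = cat v t

/-- The class `J`. -/
def ClassJ (w : M) : Prop :=
  ∀ v : M, SubA v w → ∀ x z y : M, ClassA y → cat x y = cat z v →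
    ∃ u : M, ClassA u ∧
      ((x = cat z u ∧ cat u y = v) ∨ (z = cat x u ∧ cat u v = y))

/-- `x ⪯ y`, that is, `y = x ∘ z` for some `z` in `J`. -/
def Pre (x y : M) : Prop := ∃ z : M, ClassJ z ∧ y = cat x z

/-- `x ≺ y`. -/
def SPre (x y : M) : Prop := Pre x y ∧ x ≠ y

/-! ### Number-like objects -/

/-- `0`. -/
abbrev zero : M := nil

/-- `S x`. -/
abbrev succ (x : M) : M := app x nil

/-- `1`. -/
abbrev one : M := succ zero

/-- `x + y`. -/
abbrev add (x y : M) : M := cat x y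

/-- The initial segment `[0, x]` is totally ordered by `⪯`. -/
def TotalBelow (x : M) : Prop :=
  (∀ u : M, Pre u x → Pre u u) ∧
  (∀ u v : M, Pre u x → Pre v x → Pre u v → Pre v u → u = v) ∧
  (∀ u v w : M, Pre u x → Pre v x → Pre w x → Pre u v → Pre v w → Pre u w) ∧
  (∀ u v : M, Pre u x → Pre v x → Pre u v ∨ Pre v u)

/-- The first class of number-like objects. -/
def ClassI (w : M) : Prop :=
  ClassJ w ∧ ∀ x : M, Pre x w →
    TotalBelow x ∧
    (x = zero ∨ ∃ y : M, x = succ y) ∧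
    (∀ u : M, SPre u x → Pre (succ u) x) ∧
    (∀ y : M, ClassJ y → (∀ u : M, SPre u y → Pre (succ u) y) → Pre x y ∨ Pre y x) ∧
    (∀ u : M, ClassJ u → succ (add u x) = add (succ u) x) ∧
    (∀ u v : M, ClassJ u → ClassJ v → add u x = add v x → u = v)

/-- The subclass of `ClassI` on which addition commutes. -/
def ClassC (w : M) : Prop :=
  ClassI w ∧ ∀ x u : M, Pre x w → ClassI u → add u x = add x u

/-- The class `N` of number-like objects. -/
def ClassN (x : M) : Prop := ClassC x ∧ ∀ y : M, ClassC y → ClassC (add y x)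

/-- `x ≤ y`, that is, `x + z = y` for some `z` in `N`. -/
def Le (x y : M) : Prop := ∃ z : M, ClassN z ∧ add x z = y

/-- `x < y`. -/
def Lt (x y : M) : Prop := Le x y ∧ x ≠ y

/-- The graph `z = x ∸ y` of truncated subtraction on `N`; the value is `0` if `x` or `y` is not
in `N`. -/
def IsTsub (x y z : M) : Prop :=
  (ClassN x ∧ ClassN y ∧ ClassN z ∧ add y z = x) ∨
    (¬ (ClassN x ∧ ClassN y ∧ Le y x) ∧ z = zero)

/-! ### Indexed sequences -/

/-- `f` is an indexed sequence with domain `[m, n]`, written `f : [m, n] → J`. -/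
def IsSeq (m n f : M) : Prop :=
  ClassJ f ∧ ClassN m ∧ ClassN n ∧ Le m n ∧
  (∀ k : M, Le m k → Le k n →
    ∃ u s t : M, ClassJ u ∧ ClassJ s ∧ ClassJ t ∧ f = cat (app s (app k u)) t) ∧
  (∀ s t w : M, ClassJ s → ClassJ t → ClassJ w → f = cat (app s w) t →
    ∃ k u : M, Le m k ∧ Le k n ∧ ClassJ u ∧ w = app k u) ∧
  (∀ s t k u : M, f = cat (app s (app k u)) t → s ≠ nil →
    Lt m k ∧ ∃ l v s₀ : M, ClassJ l ∧ ClassJ v ∧ ClassJ s₀ ∧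
      k = succ l ∧ s = app s₀ (app l v)) ∧
  (∀ s t k u : M, f = cat (app s (app k u)) t →
    ¬ ∃ k₁ u₁ s₀ t₀ : M, ClassN k₁ ∧ Le k k₁ ∧ ClassJ u₁ ∧ ClassJ s₀ ∧ ClassJ t₀ ∧
      s = cat (app s₀ (app k₁ u₁)) t₀)

/-- `f(k) = u`. For an indexed sequence `f` and an index `k` of its domain there is exactly one
such `u`. -/
def Val (f k u : M) : Prop :=
  ClassJ u ∧ ∃ s t : M, ClassJ s ∧ ClassJ t ∧ f = cat (app s (app k u)) t

/-- `f(i) = g(j)`. -/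
def SameVal (f i g j : M) : Prop := ∃ u : M, Val f i u ∧ Val g j u

/-- For `f : [0, n] → J`: `h : [k, k + n] → J` is the sequence `f` shifted by `k`. -/
def IsShift (k n f h : M) : Prop :=
  IsSeq k (add k n) h ∧ ∀ j : M, Le zero j → Le j n → SameVal h (add k j) f j

/-- For `f : [0, n] → J` and `g : [0, m] → J`: `h : [0, n + m + 1] → J` is the concatenation
`f ⌢ g`. -/
def IsConcat (n m f g h : M) : Prop :=
  IsSeq zero (add (add n m) one) h ∧
  (∃ g₁ : M, IsShift (add n one) m g g₁ ∧ h = cat f g₁) ∧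
  (∀ j : M, Le zero j → Le j n → SameVal h j f j) ∧
  (∀ j : M, Le (add n one) j → Le j (add (add n m) one) →
    ∃ i : M, IsTsub j (add n one) i ∧ SameVal h j g i)

end Semantics

end SeqTh

set_option linter.unusedSectionVars false

namespace SeqTh

/-! ### Interpretation of the basic terms, and products in the class A -/

section Realize

variable {M : Type*} [SeqLang.Structure M] {α : Type}

/-! `Seq` has no induction, so the proof shortens cuts. Everything needed about indexed sequences is
packed into seven properties of a number n (`Good`): constants, shifts, sums and differences exist
up to index n, sequences on [k, k+n] are determined by their values, and a block with last offset n
can be appended or cut off. Each property holds at 0 and passes from n to Sn inside N, because the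
last entry of an indexed sequence can be peeled off (`IsSeq.exists_succ`) and put back
(`IsSeq.succ`). `ClassK` makes this inductive property downward closed. Solovay's device, demanding
that y+n stay in `ClassK` for every y in it, then yields `ClassNstar`, which is closed under
addition as well.

Two inputs make this work. On J, two factorizations of one element refine each other
(`ClassJ.editor`), which gives left cancellation and uniqueness of values. On N, the initial-segment
order is linear and differences stay in N (`ClassC.pre_right`), so ≤ behaves as it should on
numbers.

Concatenation is ∘ after a shift. It is injective because the values determine both parts, and
associative because ∘ is associative on J. The editor axiom comes from comparing lengths: cut the
longer of f and p where the shorter ends, reassociate, and apply injectivity. Finally, all classes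
involved are built by first-order operations, so a single formula defines N⋆ in every structure
(`UnifDef`). -/

theorem realize_eT (v : α → M) : (eT : SeqLang.Term α).realize v = nil := by
  change FirstOrder.Language.Structure.funMap (L := SeqLang) SeqFunc.e _ = _
  unfold nil
  congr 1
  funext i
  exact i.elim0

theorem realize_appT (s t : SeqLang.Term α) (v : α → M) :
    (appT s t).realize v = app (s.realize v) (t.realize v) := by
  change FirstOrder.Language.Structure.funMap (L := SeqLang) SeqFunc.app _ = _
  unfold app
  congr 1
  funext i
  fin_cases i <;> rfl

theorem realize_catT (s t : SeqLang.Term α) (v : α → M) :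
    (catT s t).realize v = cat (s.realize v) (t.realize v) := by
  change FirstOrder.Language.Structure.funMap (L := SeqLang) SeqFunc.cat _ = _
  unfold cat
  congr 1
  funext i
  fin_cases i <;> rfl

theorem ClassA.cat {z w : M} (hz : ClassA z) (hw : ClassA w) : ClassA (cat z w) :=
  ⟨by rw [hw.2, hz.1], fun x y => by rw [hw.2, hw.2, hw.2, hz.2]⟩

end Realize

/-! ### The axioms of `Seq` in a model -/

section Axioms

variable {M : Type*} [SeqLang.Structure M] [Seq.Model M]

theorem app_ne_nil (x y : M) : app x y ≠ nil := by
  have h := FirstOrder.Language.Theory.realize_sentence_of_mem (M := M) Seq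
    (show ax1 ∈ Seq by simp [Seq])
  simp only [ax1, FirstOrder.Language.Sentence.Realize, FirstOrder.Language.Formula.Realize,
    FirstOrder.Language.BoundedFormula.realize_all, FirstOrder.Language.BoundedFormula.realize_not,
    FirstOrder.Language.BoundedFormula.realize_bdEqual, realize_appT, realize_eT] at h
  exact h x y

theorem app_inj {x₁ x₂ y₁ y₂ : M} (h : app x₁ x₂ = app y₁ y₂) : x₁ = y₁ ∧ x₂ = y₂ := by
  have h' := FirstOrder.Language.Theory.realize_sentence_of_mem (M := M) Seq
    (show ax2 ∈ Seq by simp [Seq])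
  simp only [ax2, FirstOrder.Language.Sentence.Realize, FirstOrder.Language.Formula.Realize,
    FirstOrder.Language.BoundedFormula.realize_all, FirstOrder.Language.BoundedFormula.realize_imp,
    FirstOrder.Language.BoundedFormula.realize_inf,
    FirstOrder.Language.BoundedFormula.realize_bdEqual, realize_appT] at h'
  exact h' x₁ x₂ y₁ y₂ h

theorem cat_nil (x : M) : cat x nil = x := by
  have h := FirstOrder.Language.Theory.realize_sentence_of_mem (M := M) Seq
    (show ax3 ∈ Seq by simp [Seq])
  simp only [ax3, FirstOrder.Language.Sentence.Realize, FirstOrder.Language.Formula.Realize,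
    FirstOrder.Language.BoundedFormula.realize_all,
    FirstOrder.Language.BoundedFormula.realize_bdEqual, realize_catT, realize_eT] at h
  exact h x

theorem cat_app (x y z : M) : cat x (app y z) = app (cat x y) z := by
  have h := FirstOrder.Language.Theory.realize_sentence_of_mem (M := M) Seq
    (show ax4 ∈ Seq by simp [Seq])
  simp only [ax4, FirstOrder.Language.Sentence.Realize, FirstOrder.Language.Formula.Realize,
    FirstOrder.Language.BoundedFormula.realize_all,
    FirstOrder.Language.BoundedFormula.realize_bdEqual, realize_catT, realize_appT] at h
  exact h x y z

theorem eq_nil_or_eq_app (x : M) : x = nil ∨ ∃ y z, x = app y z := by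
  have h := FirstOrder.Language.Theory.realize_sentence_of_mem (M := M) Seq
    (show ax5 ∈ Seq by simp [Seq])
  simp only [ax5, FirstOrder.Language.Sentence.Realize, FirstOrder.Language.Formula.Realize,
    FirstOrder.Language.BoundedFormula.realize_all, FirstOrder.Language.BoundedFormula.realize_sup,
    FirstOrder.Language.BoundedFormula.realize_ex,
    FirstOrder.Language.BoundedFormula.realize_bdEqual, realize_appT, realize_eT] at h
  exact h x

theorem cat_eq_nil {x y : M} (h : cat x y = nil) : x = nil ∧ y = nil := by
  rcases eq_nil_or_eq_app y with rfl | ⟨a, b, rfl⟩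
  · exact ⟨by rwa [cat_nil] at h, rfl⟩
  · exact absurd (cat_app x a b ▸ h) (app_ne_nil _ _)

/-- A concatenation `x ∘ y` that ends with the element `b` either has `y` empty, or `y` ends
with `b`. -/
theorem cat_eq_app {x y a b : M} (h : cat x y = app a b) :
    (y = nil ∧ x = app a b) ∨ ∃ y', y = app y' b ∧ cat x y' = a := by
  rcases eq_nil_or_eq_app y with rfl | ⟨c, d, rfl⟩
  · exact .inl ⟨rfl, by rwa [cat_nil] at h⟩
  · rw [cat_app] at h
    obtain ⟨h1, rfl⟩ := app_inj h
    exact .inr ⟨c, rfl, h1⟩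

end Axioms

/-! ### Closure properties of A and J, and the order ⪯ -/

section ClassJ

variable {M : Type*} [SeqLang.Structure M] [Seq.Model M]

theorem classA_nil : ClassA (nil : M) := ⟨cat_nil _, fun x y => by rw [cat_nil, cat_nil]⟩

theorem ClassA.app {z : M} (hz : ClassA z) (w : M) : ClassA (app z w) :=
  ⟨by rw [cat_app, hz.1], fun x y => by rw [cat_app, cat_app, cat_app, hz.2]⟩

theorem ClassA.of_app {z w : M} (h : ClassA (SeqTh.app z w)) : ClassA z := by
  refine ⟨?_, fun x y => ?_⟩
  · have := h.1
    rw [cat_app] at this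
    exact (app_inj this).1
  · have := h.2 x y
    rw [cat_app, cat_app, cat_app] at this
    exact (app_inj this).1

/-- The trivial equation (ew)e = ew already has a refinement with middle factor u in A, and that
factor can only be w itself unless w = e. -/
theorem ClassJ.classA {w : M} (hw : ClassJ w) : ClassA w := by
  obtain ⟨u, hu, h | h⟩ := hw w ⟨nil, classA_nil, (cat_nil w).symm⟩ (SeqTh.cat nil w) nil nil
    classA_nil (cat_nil _)
  · rw [cat_nil] at h
    exact h.2 ▸ hu
  · obtain ⟨-, rfl⟩ := cat_eq_nil h.2
    exact classA_nil

/-- This is why the definition of J quantifies over all v ⊑_A w: downward closure is then just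
transitivity of ⊑_A. -/
theorem ClassJ.of_cat {v t : M} (ht : ClassA t) (h : ClassJ (cat v t)) : ClassJ v := by
  rintro v' ⟨t', ht', rfl⟩
  exact h v' ⟨SeqTh.cat t' t, ht'.cat ht, (ht.2 _ _).symm⟩

theorem ClassJ.of_app {v a : M} (h : ClassJ (app v a)) : ClassJ v := by
  refine ClassJ.of_cat (classA_nil.app a) ?_
  rwa [cat_app, cat_nil]

/-- The editor property: two factorizations of the same element have a common refinement. -/
theorem ClassJ.editor {v x y z : M} (hv : ClassJ v) (hy : ClassJ y)
    (h : SeqTh.cat x y = SeqTh.cat z v) :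
    ∃ u, ClassJ u ∧ ((x = SeqTh.cat z u ∧ SeqTh.cat u y = v) ∨
      (z = SeqTh.cat x u ∧ SeqTh.cat u v = y)) := by
  obtain ⟨u, -, h | h⟩ := hv v ⟨nil, classA_nil, (cat_nil v).symm⟩ x z y hy.classA h
  · exact ⟨u, ClassJ.of_cat hy.classA (h.2 ▸ hv), .inl h⟩
  · exact ⟨u, ClassJ.of_cat hv.classA (h.2 ▸ hy), .inr h⟩

theorem classJ_nil : ClassJ (nil : M) := by
  rintro v ⟨t, -, h⟩ x z y hy hxy
  obtain ⟨rfl, rfl⟩ := cat_eq_nil h.symm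
  rw [cat_nil] at hxy
  exact ⟨y, hy, .inr ⟨hxy.symm, cat_nil y⟩⟩

theorem ClassJ.app {w : M} (hw : ClassJ w) (a : M) : ClassJ (app w a) := by
  rintro v ⟨t, ht, h⟩ x z y hy hxy
  rcases cat_eq_app h.symm with ⟨rfl, rfl⟩ | ⟨t', rfl, rfl⟩
  · rw [cat_app] at hxy
    rcases cat_eq_app hxy with ⟨rfl, rfl⟩ | ⟨y', rfl, hy'⟩
    · exact ⟨SeqTh.app w a, hw.classA.app a, .inl ⟨(cat_app _ _ _).symm, cat_nil _⟩⟩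
    · obtain ⟨u, hu, h | h⟩ := hw w ⟨nil, classA_nil, (cat_nil w).symm⟩ x z y' hy.of_app hy'
      · exact ⟨u, hu, .inl ⟨h.1, by rw [cat_app, h.2]⟩⟩
      · exact ⟨u, hu, .inr ⟨h.1, by rw [cat_app, h.2]⟩⟩
  · exact hw v ⟨t', ht.of_app, rfl⟩ x z y hy hxy

/-- Refinement for w₂ locates the cut v inside w₁w₂. If v ends within w₁, the hypothesis on w₁
applies. Otherwise v = w₁u, and xy = (zw₁)u is refined first at u; if x ends before u begins, a
second refinement at w₁ compares x with z. -/
theorem ClassJ.cat {w₁ w₂ : M} (h₁ : ClassJ w₁) (h₂ : ClassJ w₂) : ClassJ (cat w₁ w₂) := by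
  rintro v ⟨t, ht, h⟩ x z y hy hxy
  obtain ⟨u, hu, ⟨rfl, rfl⟩ | ⟨rfl, -⟩⟩ :=
    h₂ w₂ ⟨nil, classA_nil, (cat_nil w₂).symm⟩ v w₁ t ht h.symm
  · rw [hu.2] at hxy
    obtain ⟨r, hr, ⟨rfl, rfl⟩ | ⟨h3, rfl⟩⟩ := h₂ u ⟨t, ht, rfl⟩ x _ y hy hxy
    · exact ⟨SeqTh.cat w₁ r, h₁.classA.cat hr, .inl ⟨(hr.2 _ _).symm, (hy.2 _ _).symm⟩⟩
    · obtain ⟨q, hq, ⟨rfl, rfl⟩ | ⟨rfl, rfl⟩⟩ :=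
        h₁ w₁ ⟨nil, classA_nil, (cat_nil w₁).symm⟩ x z r hr h3.symm
      · exact ⟨q, hq, .inl ⟨rfl, hu.2 _ _⟩⟩
      · exact ⟨q, hq, .inr ⟨rfl, hu.2 _ _⟩⟩
  · exact h₁ v ⟨u, hu, rfl⟩ x z y hy hxy

theorem ClassJ.cat_assoc {z : M} (hz : ClassJ z) (x y : M) :
    SeqTh.cat (SeqTh.cat x y) z = SeqTh.cat x (SeqTh.cat y z) := (hz.classA.2 x y).symm

theorem ClassJ.nil_cat {z : M} (hz : ClassJ z) : SeqTh.cat nil z = z := hz.classA.1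

theorem Pre.refl (x : M) : Pre x x := ⟨nil, classJ_nil, (cat_nil x).symm⟩

theorem Pre.trans {x y z : M} : Pre x y → Pre y z → Pre x z := by
  rintro ⟨a, ha, rfl⟩ ⟨b, hb, rfl⟩
  exact ⟨cat a b, ha.cat hb, hb.cat_assoc _ _⟩

theorem Pre.succ (x : M) : Pre x (succ x) :=
  ⟨SeqTh.succ nil, classJ_nil.app nil, by rw [cat_app, cat_nil]⟩

theorem Pre.classJ {x y : M} (h : Pre x y) (hy : ClassJ y) : ClassJ x := by
  obtain ⟨z, hz, rfl⟩ := h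
  exact hy.of_cat hz.classA

theorem ClassJ.nil_pre {x : M} (hx : ClassJ x) : Pre nil x := ⟨x, hx, hx.nil_cat.symm⟩

theorem pre_app {x w a : M} (h : Pre x (app w a)) : x = app w a ∨ Pre x w := by
  obtain ⟨z, hz, h⟩ := h
  rcases cat_eq_app h.symm with ⟨-, rfl⟩ | ⟨z', rfl, rfl⟩
  · exact .inl rfl
  · exact .inr ⟨z', hz.of_app, rfl⟩

theorem pre_nil {x : M} (h : Pre x nil) : x = nil := by
  obtain ⟨z, -, h⟩ := h
  exact (cat_eq_nil h.symm).1

end ClassJ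

/-! ### The classes I, C and N, cancellation, order and subtraction -/

section Numbers

variable {M : Type*} [SeqLang.Structure M] [Seq.Model M]

theorem ClassI.of_pre {x w : M} (hw : ClassI w) (h : Pre x w) : ClassI x :=
  ⟨h.classJ hw.1, fun _ hy => hw.2 _ (hy.trans h)⟩

theorem classI_nil : ClassI (nil : M) := by
  refine ⟨classJ_nil, fun x hx => ?_⟩
  obtain rfl := pre_nil hx
  refine ⟨⟨fun u _ => Pre.refl u, fun u v hu hv _ _ => (pre_nil hu).trans (pre_nil hv).symm,
    fun _ _ _ _ _ _ => Pre.trans, fun u v hu hv => .inl ?_⟩, .inl rfl, fun u hu => ?_,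
    fun y hy _ => .inl hy.nil_pre, fun u _ => ?_, fun u v _ _ h => ?_⟩
  · rw [pre_nil hu, pre_nil hv]
    exact Pre.refl _
  · exact absurd (pre_nil hu.1) hu.2
  · simp only [succ, add, cat_nil]
  · simpa only [add, cat_nil] using h

theorem ClassI.succ {w : M} (hw : ClassI w) : ClassI (succ w) := by
  refine ⟨hw.1.app nil, fun x hx => ?_⟩
  rcases pre_app hx with rfl | hx
  swap
  · exact hw.2 x hx
  obtain ⟨⟨-, has, -, htot⟩, -, hS, hcmp, hadd, hcan⟩ := hw.2 w (Pre.refl w)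
  refine ⟨⟨fun u _ => Pre.refl u, fun u v hu hv huv hvu => ?_, fun _ _ _ _ _ _ => Pre.trans,
    fun u v hu hv => ?_⟩, .inr ⟨w, rfl⟩, fun u hu => ?_, fun y hy h => ?_, fun u hu => ?_,
    fun u v hu hv h => ?_⟩
  -- Nothing yet excludes Sw ⪯ w. If it happens, antisymmetry below w collapses u, w and Sw to one
  -- element, so antisymmetry survives below Sw.
  · have key : ∀ u : M, Pre u w → Pre (SeqTh.succ w) u → u = SeqTh.succ w := fun u hu h => by
      have h1 : SeqTh.succ w = w := has _ _ (h.trans hu) (Pre.refl w) (h.trans hu) (Pre.succ w)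
      have h2 : u = w := has _ _ hu (Pre.refl w) hu ((Pre.succ w).trans h)
      rw [h1, h2]
    rcases pre_app hu with rfl | hu <;> rcases pre_app hv with rfl | hv
    · rfl
    · exact (key v hv huv).symm
    · exact key u hu hvu
    · exact has u v hu hv huv hvu
  · rcases pre_app hu with rfl | hu <;> rcases pre_app hv with rfl | hv
    · exact .inl (Pre.refl _)
    · exact .inr (hv.trans (Pre.succ w))
    · exact .inl (hu.trans (Pre.succ w))
    · exact htot u v hu hv
  · rcases pre_app hu.1 with h | h
    · exact absurd h hu.2
    · by_cases huw : u = w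
      · rw [huw]
        exact Pre.refl _
      · exact (hS u ⟨h, huw⟩).trans (Pre.succ w)
  · rcases hcmp y hy h with h' | h'
    · by_cases hwy : w = y
      · exact .inr (hwy ▸ Pre.succ w)
      · exact .inl (h w ⟨h', hwy⟩)
    · exact .inr (h'.trans (Pre.succ w))
  · have := hadd u hu
    simp only [SeqTh.succ, add, cat_app] at this ⊢
    rw [this]
  · simp only [add, cat_app] at h
    exact hcan u v hu hv (app_inj h).1

theorem ClassI.antisymm {x u v : M} (hx : ClassI x) (hu : Pre u x) (hv : Pre v x)
    (huv : Pre u v) (hvu : Pre v u) : u = v :=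
  (hx.2 x (Pre.refl x)).1.2.1 u v hu hv huv hvu

theorem ClassI.succ_cat {x u : M} (hx : ClassI x) (hu : ClassJ u) :
    app (cat u x) nil = cat (app u nil) x :=
  (hx.2 x (Pre.refl x)).2.2.2.2.1 u hu

theorem ClassI.right_cancel {x u v : M} (hx : ClassI x) (hu : ClassJ u) (hv : ClassJ v)
    (h : cat u x = cat v x) : u = v :=
  (hx.2 x (Pre.refl x)).2.2.2.2.2 u v hu hv h

/-- If x = Sx, then 0 + x = S0 + x, and right cancellation gives 0 = S0. -/
theorem ClassI.ne_succ {x : M} (hx : ClassI x) : x ≠ app x nil := by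
  intro h
  have h1 : cat (nil : M) x = cat (app nil nil) x := by
    rw [← hx.succ_cat classJ_nil, hx.1.nil_cat]
    exact h
  exact app_ne_nil _ _ (hx.right_cancel classJ_nil (classJ_nil.app nil) h1).symm

/-- A number-like object absorbs nothing on the right. -/
theorem ClassI.eq_nil_of_cat_eq {x r : M} (hx : ClassI x) (hr : ClassJ r) (h : x = cat x r) :
    r = nil := by
  rcases eq_nil_or_eq_app r with rfl | ⟨r', c, rfl⟩
  · rfl
  exfalso
  rw [cat_app] at h
  -- Here x = xr' ⊢ c, so xr' and x are initial segments of each other and coincide, giving x = x ⊢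
  -- c. As x is a successor, c = e, and then x = Sx.
  have h1 : Pre (cat x r') x :=
    ⟨SeqTh.app nil c, classJ_nil.app c, by rw [cat_app, cat_nil]; exact h⟩
  have h2 : cat x r' = x :=
    hx.antisymm h1 (Pre.refl x) h1 ⟨r', hr.of_app, rfl⟩
  rw [h2] at h
  rcases (hx.2 x (Pre.refl x)).2.1 with h0 | ⟨y, hy⟩
  · exact app_ne_nil _ _ (h.symm.trans h0)
  · obtain ⟨-, rfl⟩ := app_inj (h.symm.trans hy)
    exact hx.ne_succ h

/-- The common refinement of xa = xb has a middle factor r with x = xr, and such an r is empty. -/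
theorem ClassI.left_cancel {x a b : M} (hx : ClassI x) (ha : ClassJ a) (hb : ClassJ b)
    (h : cat x a = cat x b) : a = b := by
  obtain ⟨r, hr, ⟨h1, h2⟩ | ⟨h1, h2⟩⟩ := hb.editor ha h
  · rw [hx.eq_nil_of_cat_eq hr h1, ha.nil_cat] at h2
    exact h2
  · rw [hx.eq_nil_of_cat_eq hr h1, hb.nil_cat] at h2
    exact h2.symm

theorem ClassC.of_pre {x w : M} (hw : ClassC w) (h : Pre x w) : ClassC x :=
  ⟨hw.1.of_pre h, fun _ _ hy hu => hw.2 _ _ (hy.trans h) hu⟩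

theorem ClassC.comm {x u : M} (hx : ClassC x) (hu : ClassI u) : cat u x = cat x u :=
  hx.2 x u (Pre.refl x) hu

theorem classC_nil : ClassC (nil : M) := by
  refine ⟨classI_nil, fun x u hx hu => ?_⟩
  obtain rfl := pre_nil hx
  exact (cat_nil u).trans hu.1.nil_cat.symm

theorem ClassC.succ {w : M} (hw : ClassC w) : ClassC (succ w) := by
  refine ⟨hw.1.succ, fun x u hx hu => ?_⟩
  rcases pre_app hx with rfl | hx
  · change cat u (SeqTh.app w nil) = cat (SeqTh.app w nil) u
    rw [cat_app, hw.comm hu, hu.succ_cat hw.1.1]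
  · exact hw.2 x u hx hu

/-- The difference of two comparable number-like objects is again one. -/
theorem ClassC.pre_right {x z : M} (hz : ClassJ z) (h : ClassC (cat x z)) : Pre z (cat x z) := by
  have hx : ClassC x := h.of_pre ⟨z, hz, rfl⟩
  -- The comparability clause of I accepts only elements closed under this step. Cancelling x on the
  -- left transfers it from xz to z.
  have hstep : ∀ u : M, SPre u z → Pre (SeqTh.succ u) z := by
    rintro u ⟨⟨s, hs, rfl⟩, hne⟩
    have hu : ClassJ u := hz.of_cat hs.classA
    have h1 : SPre (cat x u) (cat x (cat u s)) :=
      ⟨⟨s, hs, (hs.cat_assoc _ _).symm⟩, fun h' => hne (hx.1.left_cancel hu hz h')⟩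
    obtain ⟨p, hp, h2⟩ := (h.1.2 _ (Pre.refl _)).2.2.1 _ h1
    refine ⟨p, hp, ?_⟩
    refine hx.1.left_cancel hz ((hu.app nil).cat hp) ?_
    rw [h2, ← hp.cat_assoc, cat_app]
  rcases (h.1.2 _ (Pre.refl _)).2.2.2.1 z hz hstep with ⟨p, hp, h1⟩ | h1
  swap
  · exact h1
  -- In the wrong case z = (xz)p, commuting x past xz shows that xz absorbs xp. Hence x = e, and the
  -- claim is trivial.
  have h2 : cat x z = cat (cat x z) (cat x p) := by
    rw [← hp.cat_assoc, ← h.comm hx.1, hp.cat_assoc, ← h1]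
  have h3 := h.1.eq_nil_of_cat_eq (hx.1.1.cat hp) h2
  obtain ⟨rfl, -⟩ := cat_eq_nil h3
  rw [hz.nil_cat]
  exact Pre.refl z

theorem ClassN.classI {x : M} (h : ClassN x) : ClassI x := h.1.1
theorem ClassN.classJ {x : M} (h : ClassN x) : ClassJ x := h.1.1.1

theorem ClassN.of_pre {x w : M} (hw : ClassN w) (h : Pre x w) : ClassN x := by
  refine ⟨hw.1.of_pre h, fun y hy => (hw.2 y hy).of_pre ?_⟩
  obtain ⟨z, hz, rfl⟩ := h
  exact ⟨z, hz, (hz.cat_assoc _ _).symm⟩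

theorem classN_nil : ClassN (nil : M) :=
  ⟨classC_nil, fun y hy => by rw [add, cat_nil]; exact hy⟩

theorem ClassN.succ {x : M} (hx : ClassN x) : ClassN (app x nil) :=
  ⟨hx.1.succ, fun y hy => by rw [add, cat_app]; exact (hx.2 y hy).succ⟩

theorem ClassN.cat {x y : M} (hx : ClassN x) (hy : ClassN y) : ClassN (cat x y) :=
  ⟨hy.2 x hx.1, fun z hz => by
    rw [add, ← hy.classJ.cat_assoc]; exact hy.2 _ (hx.2 z hz)⟩

theorem ClassN.comm {x y : M} (hx : ClassN x) (hy : ClassN y) :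
    SeqTh.cat x y = SeqTh.cat y x := hy.1.comm hx.1.1

theorem ClassN.of_cat_right {x y : M} (h : ClassN (SeqTh.cat x y)) (hy : ClassJ y) : ClassN y :=
  h.of_pre (h.1.pre_right hy)

theorem ClassN.eq_nil_or_eq_succ {x : M} (hx : ClassN x) :
    x = nil ∨ ∃ y, ClassN y ∧ x = app y nil := by
  rcases (hx.classI.2 x (Pre.refl x)).2.1 with h | ⟨y, rfl⟩
  · exact .inl h
  · exact .inr ⟨y, hx.of_pre (Pre.succ y), rfl⟩

theorem ClassN.left_cancel {x a b : M} (hx : ClassN x) (ha : ClassN a) (hb : ClassN b)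
    (h : SeqTh.cat x a = SeqTh.cat x b) : a = b :=
  hx.classI.left_cancel ha.classJ hb.classJ h

theorem ClassN.succ_cat {x y : M} (hx : ClassN x) (hy : ClassN y) :
    SeqTh.cat (app x nil) y = app (SeqTh.cat x y) nil := (hy.classI.succ_cat hx.classJ).symm

theorem ClassN.ne_succ {x : M} (hx : ClassN x) : x ≠ app x nil := hx.classI.ne_succ

/-! ### The order -/

/-- A difference witnessing ⪯ is only known to lie in J; below an element of N it lies in N. This
lets ≤ inherit the order properties of ⪯. -/
theorem le_iff_pre {x y : M} (hy : ClassN y) : Le x y ↔ Pre x y := by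
  constructor
  · rintro ⟨z, hz, rfl⟩
    exact ⟨z, hz.classJ, rfl⟩
  · rintro ⟨z, hz, rfl⟩
    exact ⟨z, hy.of_cat_right hz, rfl⟩

theorem Le.classN {x y : M} (h : Le x y) (hy : ClassN y) : ClassN x :=
  hy.of_pre ((le_iff_pre hy).1 h)

theorem Le.refl (x : M) : Le x x := ⟨nil, classN_nil, cat_nil x⟩

theorem Le.trans {x y z : M} : Le x y → Le y z → Le x z := by
  rintro ⟨a, ha, rfl⟩ ⟨b, hb, rfl⟩
  exact ⟨cat a b, ha.cat hb, (hb.classJ.cat_assoc _ _).symm⟩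

theorem Le.antisymm {x y : M} (hy : ClassN y) (h1 : Le x y) (h2 : Le y x) : x = y :=
  hy.classI.antisymm ((le_iff_pre hy).1 h1) (Pre.refl y) ((le_iff_pre hy).1 h1)
    ((le_iff_pre (h1.classN hy)).1 h2)

theorem le_add {x y : M} (hy : ClassN y) : Le x (cat x y) := ⟨y, hy, rfl⟩

theorem le_succ (x : M) : Le x (app x nil) :=
  ⟨app nil nil, classN_nil.succ, by rw [add, cat_app, cat_nil]⟩

theorem nil_le {x : M} (hx : ClassN x) : Le nil x := ⟨x, hx, hx.classJ.nil_cat⟩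

theorem le_nil {x : M} (h : Le x nil) : x = nil := by
  obtain ⟨z, -, h⟩ := h
  exact (cat_eq_nil h).1

theorem le_succ_iff {x y : M} : Le x (app y nil) ↔ Le x y ∨ x = app y nil := by
  constructor
  · rintro ⟨z, hz, h⟩
    rcases cat_eq_app h with ⟨-, rfl⟩ | ⟨z', rfl, rfl⟩
    · exact .inr rfl
    · exact .inl ⟨z', hz.of_pre (Pre.succ z'), rfl⟩
  · rintro (h | rfl)
    · exact h.trans (le_succ y)
    · exact Le.refl _

theorem not_succ_le {x : M} (hx : ClassN x) : ¬ Le (app x nil) x := fun h =>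
  hx.ne_succ (Le.antisymm hx.succ (le_succ x) h)

/-- By commutativity both x and y are initial segments of x + y, below which ⪯ is total. -/
theorem Le.total {x y : M} (hx : ClassN x) (hy : ClassN y) : Le x y ∨ Le y x := by
  have h := hx.cat hy
  have h1 : Pre x (cat x y) := ⟨y, hy.classJ, rfl⟩
  have h2 : Pre y (cat x y) := ⟨x, hx.classJ, hx.comm hy⟩
  rcases (h.classI.2 _ (Pre.refl _)).1.2.2.2 x y h1 h2 with h | h
  · exact .inl ((le_iff_pre hy).2 h)
  · exact .inr ((le_iff_pre hx).2 h)

theorem Lt.exists_eq {x y : M} (hx : ClassN x) (h : Lt x y) : ∃ d, ClassN d ∧ y = cat (app x nil) d := by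
  obtain ⟨⟨z, hz, rfl⟩, hne⟩ := h
  rcases hz.eq_nil_or_eq_succ with rfl | ⟨d, hd, rfl⟩
  · exact absurd (cat_nil x).symm hne
  · refine ⟨d, hd, ?_⟩
    rw [add, cat_app, hd.classI.succ_cat hx.classJ]

theorem lt_succ_of_le {x y : M} (hy : ClassN y) (h : Le x y) : Lt x (app y nil) :=
  ⟨h.trans (le_succ y), fun h' => not_succ_le hy (h' ▸ h)⟩

theorem add_le_add_iff {x a b : M} (hx : ClassN x) (ha : ClassN a) (hb : ClassN b) :
    Le (cat x a) (cat x b) ↔ Le a b := by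
  constructor
  · rintro ⟨z, hz, h⟩
    refine ⟨z, hz, hx.left_cancel (ha.cat hz) hb ?_⟩
    rw [← hz.classJ.cat_assoc]
    exact h
  · rintro ⟨z, hz, rfl⟩
    exact ⟨z, hz, hz.classJ.cat_assoc _ _⟩

/-! ### Truncated subtraction -/

theorem IsTsub.unique {x y z z' : M} (h : IsTsub x y z) (h' : IsTsub x y z') : z = z' := by
  rcases h with ⟨hx, hy, hz, h⟩ | ⟨hn, rfl⟩ <;> rcases h' with ⟨hx', hy', hz', h'⟩ | ⟨hn', rfl⟩
  · exact hy.left_cancel hz hz' (h.trans h'.symm)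
  · exact absurd ⟨hx, hy, z, hz, h⟩ hn'
  · exact absurd ⟨hx', hy', z', hz', h'⟩ hn
  · rfl

theorem IsTsub.classJ {x y z : M} (h : IsTsub x y z) : ClassJ z := by
  rcases h with ⟨-, -, hz, -⟩ | ⟨-, rfl⟩
  · exact hz.classJ
  · exact classJ_nil

theorem exists_isTsub (x y : M) : ∃ z, IsTsub x y z := by
  by_cases h : ClassN x ∧ ClassN y ∧ Le y x
  · obtain ⟨hx, hy, z, hz, h⟩ := h
    exact ⟨z, .inl ⟨hx, hy, hz, h⟩⟩
  · exact ⟨nil, .inr ⟨h, rfl⟩⟩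

theorem isTsub_cat {x y : M} (hx : ClassN x) (hy : ClassN y) : IsTsub (cat x y) x y :=
  .inl ⟨hx.cat hy, hx, hy, rfl⟩

end Numbers

/-! ### Indexed sequences, their values, and the inductive properties -/

section Sequences

variable {M : Type*} [SeqLang.Structure M] [Seq.Model M]

theorem IsSeq.classJ {m n f : M} (h : IsSeq m n f) : ClassJ f := h.1
theorem IsSeq.left {m n f : M} (h : IsSeq m n f) : ClassN m := h.2.1
theorem IsSeq.right {m n f : M} (h : IsSeq m n f) : ClassN n := h.2.2.1

theorem classN_of_lt {m k : M} (hm : ClassN m) (h : Lt m k) : ClassN k := by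
  obtain ⟨⟨z, hz, rfl⟩, -⟩ := h
  exact hm.cat hz

theorem classJ_pair {k : M} (hk : ClassN k) (u : M) : ClassJ (app k u) := hk.classJ.app u

theorem cat_eq_app_of_eq {f s t a w : M} (h : f = cat (app s w) t) :
    app f a = cat (app s w) (app t a) := by
  rw [cat_app, h]

/-- Decompositions of a sequence with one element appended. -/
theorem app_eq_cat {f a s t w : M} (h : app f a = cat (app s w) t) :
    (t = nil ∧ s = f ∧ w = a) ∨ ∃ t', t = app t' a ∧ f = cat (app s w) t' := by
  rcases cat_eq_app h.symm with ⟨rfl, h'⟩ | ⟨t', rfl, rfl⟩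
  · obtain ⟨rfl, rfl⟩ := app_inj h'
    exact .inl ⟨rfl, rfl, rfl⟩
  · exact .inr ⟨t', rfl, rfl⟩

theorem cat_app_left_ne_nil {s w t : M} : cat (app s w) t ≠ nil := fun h =>
  app_ne_nil _ _ (cat_eq_nil h).1

/-- Index n occurs somewhere. An entry after it at the end of f would have an index k ≤ n, although
a larger or equal index precedes it, which clause (4) forbids. -/
theorem IsSeq.exists_last {m n f : M} (h : IsSeq m n f) :
    ∃ s u, ClassJ s ∧ ClassJ u ∧ f = app s (app n u) := by
  obtain ⟨hf, hm, hn, hmn, h1, h2, h3, h4⟩ := h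
  obtain ⟨u, s, t, hu, hs, ht, hfe⟩ := h1 n hmn (Le.refl n)
  rcases eq_nil_or_eq_app t with rfl | ⟨t', w, rfl⟩
  · exact ⟨s, u, hs, hu, by rwa [cat_nil] at hfe⟩
  exfalso
  have hs' : ClassJ (cat (app s (app n u)) t') := (hs.app _).cat ht.of_app
  have hfe' : f = cat (app (cat (app s (app n u)) t') w) nil := by
    rw [cat_nil, hfe, cat_app]
  rcases eq_nil_or_eq_app w with rfl | ⟨k, v, rfl⟩
  · obtain ⟨k, v, -, -, -, hk⟩ := h2 _ _ _ hs' classJ_nil classJ_nil hfe'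
    exact app_ne_nil _ _ hk.symm
  -- Clause (2) speaks only of entries in J. Clause (3), which has no such restriction, first shows
  -- that k is in N.
  · have hk := classN_of_lt hm (h3 _ _ _ _ hfe' cat_app_left_ne_nil).1
    obtain ⟨k', v', -, hkn, hv, he⟩ := h2 _ _ _ hs' classJ_nil (classJ_pair hk v) hfe'
    obtain ⟨rfl, rfl⟩ := app_inj he
    exact h4 _ _ _ _ hfe' ⟨n, u, s, t', hn, hkn, hu, hs, ht.of_app, rfl⟩

theorem isSeq_singleton {m u : M} (hm : ClassN m) (hu : ClassJ u) :
    IsSeq m m (app nil (app m u)) := by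
  have key : ∀ s t w : M, app nil (app m u) = cat (app s w) t → s = nil ∧ w = app m u := by
    intro s t w h
    rcases app_eq_cat h with ⟨-, h1, h2⟩ | ⟨t', -, h⟩
    · exact ⟨h1, h2⟩
    · exact absurd h.symm cat_app_left_ne_nil
  refine ⟨classJ_nil.app _, hm, hm, Le.refl m, fun k h1 h2 => ?_, fun s t w _ _ _ h => ?_,
    fun s t k v h hs => absurd (key _ _ _ h).1 hs, fun s t k v h => ?_⟩
  · obtain rfl := Le.antisymm hm h2 h1
    exact ⟨u, nil, nil, hu, classJ_nil, classJ_nil, (cat_nil _).symm⟩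
  · exact ⟨m, u, Le.refl m, Le.refl m, hu, (key _ _ _ h).2⟩
  · rintro ⟨k₁, u₁, s₀, t₀, -, -, -, -, -, h'⟩
    rw [(key _ _ _ h).1] at h'
    exact cat_app_left_ne_nil h'.symm

theorem IsSeq.exists_singleton {m f : M} (h : IsSeq m m f) :
    ∃ u, ClassJ u ∧ f = app nil (app m u) := by
  obtain ⟨s, u, hs, hu, rfl⟩ := h.exists_last
  obtain ⟨hf, hm, hn, hmn, h1, h2, h3, h4⟩ := h
  by_cases hs0 : s = nil
  · exact ⟨u, hu, by rw [hs0]⟩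
  · exact absurd rfl (h3 s nil m u (cat_nil _).symm hs0).1.2

theorem IsSeq.succ {m n f u : M} (h : IsSeq m n f) (hu : ClassJ u) :
    IsSeq m (app n nil) (app f (app (app n nil) u)) := by
  obtain ⟨s₁, v₁, hs₁, hv₁, hlast⟩ := h.exists_last
  obtain ⟨hf, hm, hn, hmn, h1, h2, h3, h4⟩ := h
  refine ⟨hf.app _, hm, hn.succ, hmn.trans (le_succ n), fun k hk hkn => ?_,
    fun s t w hs ht hw h => ?_, fun s t k v h hs => ?_, fun s t k v h => ?_⟩
  · rcases le_succ_iff.1 hkn with hkn | rfl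
    · obtain ⟨v, s, t, hv, hs, ht, hfe⟩ := h1 k hk hkn
      exact ⟨v, s, _, hv, hs, ht.app _, cat_eq_app_of_eq hfe⟩
    · exact ⟨u, f, nil, hu, hf, classJ_nil, (cat_nil _).symm⟩
  · rcases app_eq_cat h with ⟨rfl, rfl, rfl⟩ | ⟨t', rfl, h'⟩
    · exact ⟨_, u, hmn.trans (le_succ n), Le.refl _, hu, rfl⟩
    · obtain ⟨k, v, hk, hkn, hv, rfl⟩ := h2 s t' w hs ht.of_app hw h'
      exact ⟨k, v, hk, hkn.trans (le_succ n), hv, rfl⟩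
  · rcases app_eq_cat h with ⟨rfl, rfl, h'⟩ | ⟨t', rfl, h'⟩
    · obtain ⟨rfl, rfl⟩ := app_inj h'
      -- The predecessor demanded by clause (3) is the old last entry, whose index is exactly n.
      exact ⟨lt_succ_of_le hn hmn, n, v₁, s₁, hn.classJ, hv₁, hs₁, rfl, hlast⟩
    · exact h3 s t' k v h' hs
  · rcases app_eq_cat h with ⟨rfl, rfl, h'⟩ | ⟨t', rfl, h'⟩
    · obtain ⟨rfl, rfl⟩ := app_inj h'
      rintro ⟨k₁, u₁, s₀, t₀, hk₁, hle, hu₁, hs₀, ht₀, hs'⟩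
      obtain ⟨k₂, v₂, -, hk₂, -, he⟩ := h2 _ _ _ hs₀ ht₀ (classJ_pair hk₁ u₁) hs'
      obtain ⟨rfl, -⟩ := app_inj he
      exact not_succ_le hn (hle.trans hk₂)
    · exact h4 s t' k v h'

/-- The remaining prefix cannot contain index Sn again, by clause (4) for the last entry, so its
index bound drops from Sn to n. The other clauses are inherited because they allow any tail. -/
theorem IsSeq.exists_succ {m n f : M} (hn : ClassN n) (hmn : Le m n)
    (h : IsSeq m (app n nil) f) :
    ∃ f' u, IsSeq m n f' ∧ ClassJ u ∧ f = app f' (app (app n nil) u) := by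
  obtain ⟨s, u, hs, hu, rfl⟩ := h.exists_last
  obtain ⟨hf, hm, hn', -, h1, h2, h3, h4⟩ := h
  have hne : m ≠ app n nil := fun h => not_succ_le hn (h ▸ hmn)
  refine ⟨s, u, ?_, hu, rfl⟩
  have hs0 : s ≠ nil := by
    rintro rfl
    obtain ⟨v, s, t, -, -, -, h⟩ := h1 m (Le.refl m) (hmn.trans (le_succ n))
    rcases app_eq_cat h with ⟨-, -, h⟩ | ⟨t', -, h⟩
    · exact hne (app_inj h).1
    · exact cat_app_left_ne_nil h.symm
  refine ⟨hs, hm, hn, hmn, fun k hk hkn => ?_, fun s' t w hs' ht hw h => ?_,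
    fun s' t k v h hs => ?_, fun s' t k v h => ?_⟩
  · obtain ⟨v, s', t, hv, hs', ht, h⟩ := h1 k hk (hkn.trans (le_succ n))
    rcases app_eq_cat h with ⟨-, -, h'⟩ | ⟨t', rfl, h'⟩
    · obtain ⟨rfl, -⟩ := app_inj h'
      exact absurd hkn (not_succ_le hn)
    · exact ⟨v, s', t', hv, hs', ht.of_app, h'⟩
  · obtain ⟨k, v, hk, hkn, hv, rfl⟩ := h2 s' _ w hs' (ht.app _) hw (cat_eq_app_of_eq h)
    refine ⟨k, v, hk, ?_, hv, rfl⟩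
    rcases le_succ_iff.1 hkn with h' | rfl
    · exact h'
    · exact absurd ⟨_, v, s', t, hn', Le.refl _, hv, hs', ht, h⟩
        (h4 s nil _ u (cat_nil _).symm)
  · exact h3 s' _ k v (cat_eq_app_of_eq h) hs
  · exact h4 s' _ k v (cat_eq_app_of_eq h)

theorem IsSeq.right_unique {m n n' f : M} (h : IsSeq m n f) (h' : IsSeq m n' f) : n = n' := by
  obtain ⟨s, u, -, -, rfl⟩ := h.exists_last
  obtain ⟨s', u', -, -, he⟩ := h'.exists_last
  exact (app_inj (app_inj he).2).1

/-! ### Values -/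

theorem IsSeq.exists_val {m n f k : M} (h : IsSeq m n f) (hk : Le m k) (hkn : Le k n) :
    ∃ u, Val f k u := by
  obtain ⟨u, s, t, hu, hs, ht, hf⟩ := h.2.2.2.2.1 k hk hkn
  exact ⟨u, hu, s, t, hs, ht, hf⟩

/-- Refining two factorizations of f around an entry of index k puts one occurrence at or before the
other; a strictly earlier one violates clause (4). -/
theorem IsSeq.val_unique {m n f k u u' : M} (h : IsSeq m n f) (hk : ClassN k)
    (h1 : Val f k u) (h2 : Val f k u') : u = u' := by
  have h4 := h.2.2.2.2.2.2.2
  have key : ∀ {s t u s' t' u' r : M}, ClassJ u' → ClassJ s → ClassJ s' → ClassJ r →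
      f = cat (app s (app k u)) t → app s (app k u) = cat (app s' (app k u')) r → u = u' := by
    intro s t u s' t' u' r hu' hs hs' hr hf he
    rcases app_eq_cat he with ⟨-, -, h⟩ | ⟨r', rfl, h⟩
    · exact (app_inj h).2.symm
    · exact absurd ⟨k, u', s', r', hk, Le.refl k, hu', hs', hr.of_app, h⟩ (h4 _ _ _ _ hf)
  obtain ⟨hu, s, t, hs, ht, hf⟩ := h1
  obtain ⟨hu', s', t', hs', ht', hf'⟩ := h2
  obtain ⟨r, hr, ⟨he, -⟩ | ⟨he, -⟩⟩ := ht'.editor ht (hf.symm.trans hf')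
  · exact key (t' := t) hu' hs hs' hr hf he
  · exact (key (t' := t) hu hs' hs hr hf' he).symm

theorem Val.app {f k u : M} (h : Val f k u) (a : M) : Val (app f a) k u := by
  obtain ⟨hu, s, t, hs, ht, hf⟩ := h
  exact ⟨hu, s, _, hs, ht.app a, cat_eq_app_of_eq hf⟩

theorem val_last {f k u : M} (hf : ClassJ f) (hu : ClassJ u) : Val (app f (app k u)) k u :=
  ⟨hu, f, nil, hf, classJ_nil, (cat_nil _).symm⟩

theorem Val.of_app {f k l u v : M} (h : Val (SeqTh.app f (SeqTh.app l v)) k u) :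
    Val f k u ∨ k = l ∧ u = v := by
  obtain ⟨hu, s, t, hs, ht, hf⟩ := h
  rcases app_eq_cat hf with ⟨-, -, h⟩ | ⟨t', rfl, h⟩
  · exact .inr (app_inj h)
  · exact .inl ⟨hu, s, t', hs, ht.of_app, h⟩

theorem Val.cat_right {f g k u : M} (h : Val f k u) (hg : ClassJ g) : Val (cat f g) k u := by
  obtain ⟨hu, s, t, hs, ht, rfl⟩ := h
  exact ⟨hu, s, cat t g, hs, ht.cat hg, hg.cat_assoc _ _⟩

theorem Val.cat_left {f g k u : M} (h : Val g k u) (hf : ClassJ f) : Val (cat f g) k u := by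
  obtain ⟨hu, s, t, hs, ht, rfl⟩ := h
  exact ⟨hu, cat f s, t, hf.cat hs, ht, by rw [← ht.cat_assoc, cat_app]⟩

theorem IsSeq.sameVal_iff {m n f i g j u : M} (h : IsSeq m n g) (hj : ClassN j)
    (hu : Val g j u) : SameVal f i g j ↔ Val f i u :=
  ⟨fun ⟨_, h1, h2⟩ => h.val_unique hj hu h2 ▸ h1, fun h1 => ⟨u, h1, hu⟩⟩

theorem SameVal.symm {f i g j : M} (h : SameVal f i g j) : SameVal g j f i :=
  h.imp fun _ h => h.symm

theorem SameVal.trans {m n f i g j h k : M} (hg : IsSeq m n g) (hj : ClassN j)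
    (h1 : SameVal f i g j) (h2 : SameVal g j h k) : SameVal f i h k := by
  obtain ⟨u, hu, hu'⟩ := h1
  exact ⟨u, hu, (hg.sameVal_iff hj hu').1 h2.symm⟩

/-! ### Inductive properties -/

/-- There is a sequence on `[k, k + n]` whose `j`-th value is related to `j` by `R`. -/
def HasSeq (R : M → M → Prop) (k n : M) : Prop :=
  ∃ h : M, IsSeq k (cat k n) h ∧ ∀ j : M, Le nil j → Le j n → ∃ v : M, Val h (cat k j) v ∧ R j v

theorem hasSeq_nil {R : M → M → Prop} {k v : M} (hk : ClassN k) (hv : ClassJ v) (h : R nil v) :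
    HasSeq R k nil := by
  refine ⟨app nil (app k v), ?_, fun j _ hj => ⟨v, ?_, ?_⟩⟩
  · rw [cat_nil]
    exact isSeq_singleton hk hv
  · rw [le_nil hj, cat_nil]
    exact val_last classJ_nil hv
  · rwa [le_nil hj]

/-- The common induction step for constants, shifts, sums and differences: only one new value has to
be supplied. -/
theorem HasSeq.succ {R : M → M → Prop} {k n v : M} (h : HasSeq R k n)
    (hv : ClassJ v) (hR : R (app n nil) v) : HasSeq R k (app n nil) := by
  obtain ⟨f, hf, hval⟩ := h
  refine ⟨app f (app (app (cat k n) nil) v), ?_, fun j hj0 hj => ?_⟩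
  · rw [cat_app]
    exact hf.succ hv
  · rcases le_succ_iff.1 hj with hj | rfl
    · obtain ⟨w, hw, hRw⟩ := hval j hj0 hj
      exact ⟨w, hw.app _, hRw⟩
    · rw [cat_app]
      exact ⟨v, val_last hf.classJ hv, hR⟩

/-- Constant sequences. -/
def HasConst (n : M) : Prop := ∀ x : M, ClassJ x → HasSeq (fun _ v => v = x) nil n

/-- Initial parts of sequences can be moved to another starting index. -/
def HasShift (n : M) : Prop :=
  ∀ k l N f : M, ClassN k → ClassN N → IsSeq l (cat l N) f → Le n N →
    HasSeq (fun j v => Val f (cat l j) v) k n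

/-- Pointwise sums. -/
def HasSum (n : M) : Prop :=
  ∀ N f g : M, IsSeq nil N f → IsSeq nil N g → Le n N →
    HasSeq (fun j v => ∃ a b : M, Val f j a ∧ Val g j b ∧ v = cat a b) nil n

/-- Pointwise truncated differences. -/
def HasDiff (n : M) : Prop :=
  ∀ N f g : M, IsSeq nil N f → IsSeq nil N g → Le n N →
    HasSeq (fun j v => ∃ a b : M, Val f j a ∧ Val g j b ∧ IsTsub a b v) nil n

/-- Sequences are determined by their values. -/
def HasExt (n : M) : Prop :=
  ∀ k f g : M, IsSeq k (cat k n) f → IsSeq k (cat k n) g →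
    (∀ j : M, Le nil j → Le j n → SameVal f (cat k j) g (cat k j)) → f = g

/-- Adjacent sequences can be concatenated. -/
def HasCat (n : M) : Prop :=
  ∀ k l f g : M, IsSeq k l f → IsSeq (app l nil) (cat (app l nil) n) g →
    IsSeq k (cat (app l nil) n) (cat f g)

/-- Sequences can be split. -/
def HasSplit (n : M) : Prop :=
  ∀ k f : M, ClassN k → IsSeq nil (cat (app k nil) n) f →
    ∃ g h : M, IsSeq nil k g ∧ IsSeq (app k nil) (cat (app k nil) n) h ∧ f = cat g h

theorem hasConst_nil : HasConst (nil : M) := fun _ hx => hasSeq_nil classN_nil hx rfl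

theorem HasConst.succ {n : M} (h : HasConst n) : HasConst (app n nil) :=
  fun x hx => (h x hx).succ hx rfl

theorem hasShift_nil : HasShift (nil : M) := by
  intro k l N f hk hN hf _
  obtain ⟨u, hu⟩ := hf.exists_val (Le.refl l) (le_add hN)
  exact hasSeq_nil hk hu.1 (by rwa [cat_nil])

/-- The source sequence on [l, l+N] stays fixed while n grows up to N, so it never has to be
truncated. Sums and differences use the same arrangement. -/
theorem HasShift.succ {n : M} (h : HasShift n) : HasShift (app n nil) := by
  intro k l N f hk hN hf hn
  obtain ⟨u, hu⟩ := hf.exists_val (k := cat l (app n nil)) (le_add (hn.classN hN))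
    ((add_le_add_iff hf.left (hn.classN hN) hN).2 hn)
  exact (h k l N f hk hN hf ((le_succ n).trans hn)).succ hu.1 hu

theorem hasSum_nil : HasSum (nil : M) := by
  intro N f g hf hg hN
  obtain ⟨a, ha⟩ := hf.exists_val (Le.refl _) hN
  obtain ⟨b, hb⟩ := hg.exists_val (Le.refl _) hN
  exact hasSeq_nil classN_nil (ha.1.cat hb.1) ⟨a, b, ha, hb, rfl⟩

theorem HasSum.succ {n : M} (h : HasSum n) : HasSum (app n nil) := by
  intro N f g hf hg hN
  have hn := nil_le (hN.classN hf.right)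
  obtain ⟨a, ha⟩ := hf.exists_val hn hN
  obtain ⟨b, hb⟩ := hg.exists_val hn hN
  exact (h N f g hf hg ((le_succ n).trans hN)).succ (ha.1.cat hb.1) ⟨a, b, ha, hb, rfl⟩

theorem hasDiff_nil : HasDiff (nil : M) := by
  intro N f g hf hg hN
  obtain ⟨a, ha⟩ := hf.exists_val (Le.refl _) hN
  obtain ⟨b, hb⟩ := hg.exists_val (Le.refl _) hN
  obtain ⟨c, hc⟩ := exists_isTsub a b
  exact hasSeq_nil classN_nil hc.classJ ⟨a, b, ha, hb, hc⟩

theorem HasDiff.succ {n : M} (h : HasDiff n) : HasDiff (app n nil) := by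
  intro N f g hf hg hN
  have hn := nil_le (hN.classN hf.right)
  obtain ⟨a, ha⟩ := hf.exists_val hn hN
  obtain ⟨b, hb⟩ := hg.exists_val hn hN
  obtain ⟨c, hc⟩ := exists_isTsub a b
  exact (h N f g hf hg ((le_succ n).trans hN)).succ hc.classJ ⟨a, b, ha, hb, hc⟩

theorem hasExt_nil : HasExt (nil : M) := by
  intro k f g hf hg h
  have h0 := h nil (Le.refl _) (Le.refl _)
  rw [cat_nil] at hf hg h0
  obtain ⟨u, hu, rfl⟩ := hf.exists_singleton
  obtain ⟨v, hv, rfl⟩ := hg.exists_singleton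
  rw [hg.val_unique hf.left ((hf.sameVal_iff hf.left (val_last classJ_nil hu)).1 h0.symm)
    (val_last classJ_nil hv)]

theorem HasExt.succ {n : M} (hn : ClassN n) (ih : HasExt n) : HasExt (app n nil) := by
  intro k f g hf hg h
  have hk := hf.left
  have hlast := h _ (nil_le hn.succ) (Le.refl _)
  rw [cat_app] at hf hg hlast
  obtain ⟨f, u, hf', hu, rfl⟩ := hf.exists_succ (hk.cat hn) (le_add hn)
  obtain ⟨g, v, hg', hv, rfl⟩ := hg.exists_succ (hk.cat hn) (le_add hn)
  have huv : u = v := by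
    obtain ⟨w, hw, hw'⟩ := hlast
    rw [hf.val_unique hf.right (val_last hf'.classJ hu) hw,
      hg.val_unique hf.right (val_last hg'.classJ hv) hw']
  have hfg : f = g := by
    refine ih k f g hf' hg' fun j hj0 hj => ?_
    obtain ⟨w, hw, hw'⟩ := h j hj0 (hj.trans (le_succ n))
    -- An index k + j with j ≤ n is not that of the peeled entry, so both values are already values
    -- of the shorter sequences.
    have hne : cat k j ≠ app (cat k n) nil := by
      rw [← cat_app]
      intro he
      rw [hk.left_cancel (hj.classN hn) hn.succ he] at hj
      exact not_succ_le hn hj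
    exact ⟨w, hw.of_app.resolve_right fun h => hne h.1, hw'.of_app.resolve_right fun h => hne h.1⟩
  rw [hfg, huv]

theorem hasCat_nil : HasCat (nil : M) := by
  intro k l f g hf hg
  rw [cat_nil] at hg ⊢
  obtain ⟨u, hu, rfl⟩ := hg.exists_singleton
  rw [cat_app, cat_nil]
  exact hf.succ hu

/-- Since f(g ⊢ w) = (fg) ⊢ w, the last entry of the right factor can be removed before and restored
after concatenating. -/
theorem HasCat.succ {n : M} (hn : ClassN n) (ih : HasCat n) : HasCat (app n nil) := by
  intro k l f g hf hg
  have hl := hg.left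
  rw [cat_app] at hg ⊢
  obtain ⟨g, u, hg', hu, rfl⟩ := hg.exists_succ (hl.cat hn) (le_add hn)
  rw [cat_app]
  exact (ih k l f g hf hg').succ hu

theorem hasSplit_nil : HasSplit (nil : M) := by
  intro k f hk hf
  rw [cat_nil] at hf
  obtain ⟨f, u, hf', hu, rfl⟩ := hf.exists_succ hk (nil_le hk)
  refine ⟨f, app nil (app (app k nil) u), hf', ?_, by rw [cat_app, cat_nil]⟩
  rw [cat_nil]
  exact isSeq_singleton hk.succ hu

theorem HasSplit.succ {n : M} (hn : ClassN n) (ih : HasSplit n) : HasSplit (app n nil) := by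
  intro k f hk hf
  have hkn := hk.succ.cat hn
  rw [cat_app] at hf
  obtain ⟨f, u, hf', hu, rfl⟩ := hf.exists_succ hkn (nil_le hkn)
  obtain ⟨g, h, hg, hh, rfl⟩ := ih k f hk hf'
  refine ⟨g, app h (app (app (cat (app k nil) n) nil) u), hg, ?_, by rw [cat_app]⟩
  rw [cat_app]
  exact hh.succ hu

/-- The conjunction of the inductive properties. -/
def Good (n : M) : Prop :=
  HasConst n ∧ HasShift n ∧ HasSum n ∧ HasDiff n ∧ HasExt n ∧ HasCat n ∧ HasSplit n

theorem good_nil : Good (nil : M) :=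
  ⟨hasConst_nil, hasShift_nil, hasSum_nil, hasDiff_nil, hasExt_nil, hasCat_nil, hasSplit_nil⟩

theorem Good.succ {n : M} (hn : ClassN n) (h : Good n) : Good (app n nil) :=
  ⟨h.1.succ, h.2.1.succ, h.2.2.1.succ, h.2.2.2.1.succ, h.2.2.2.2.1.succ hn,
    h.2.2.2.2.2.1.succ hn, h.2.2.2.2.2.2.succ hn⟩

/-- The numbers below which everything is good. -/
def ClassK (n : M) : Prop := ClassN n ∧ ∀ m : M, Le m n → Good m

/-- The class `N⋆`. -/
def ClassNstar (n : M) : Prop := ClassN n ∧ ∀ y : M, ClassK y → ClassK (cat y n)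

theorem classK_nil : ClassK (nil : M) := ⟨classN_nil, fun _ hm => le_nil hm ▸ good_nil⟩

theorem ClassK.succ {n : M} (h : ClassK n) : ClassK (app n nil) := by
  refine ⟨h.1.succ, fun m hm => ?_⟩
  rcases le_succ_iff.1 hm with hm | rfl
  · exact h.2 m hm
  · exact (h.2 n (Le.refl n)).succ h.1

/-- Take y = 0 in the closure condition. -/
theorem ClassNstar.good {n : M} (h : ClassNstar n) : Good n := by
  have := (h.2 nil classK_nil).2 _ (Le.refl _)
  rwa [h.1.classJ.nil_cat] at this

theorem classNstar_nil : ClassNstar (nil : M) :=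
  ⟨classN_nil, fun y hy => by rwa [cat_nil]⟩

theorem ClassNstar.succ {n : M} (h : ClassNstar n) : ClassNstar (app n nil) :=
  ⟨h.1.succ, fun y hy => by rw [cat_app]; exact (h.2 y hy).succ⟩

theorem ClassNstar.cat {x y : M} (hx : ClassNstar x) (hy : ClassNstar y) :
    ClassNstar (cat x y) :=
  ⟨hx.1.cat hy.1, fun z hz => by
    rw [← hy.1.classJ.cat_assoc]
    exact hy.2 _ (hx.2 z hz)⟩

/-- For y ≤ x one has z + y ≤ z + x, and `ClassK` is downward closed by construction. -/
theorem ClassNstar.of_le {x y : M} (hx : ClassNstar x) (h : Le y x) : ClassNstar y := by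
  refine ⟨h.classN hx.1, fun z hz => ?_⟩
  obtain ⟨d, hd, rfl⟩ := h
  have hK := hx.2 z hz
  have hle : Le (SeqTh.cat z y) (SeqTh.cat z (add y d)) := by
    rw [add, ← hd.classJ.cat_assoc]
    exact le_add hd
  exact ⟨hle.classN hK.1, fun m hm => hK.2 m (hm.trans hle)⟩

end Sequences

/-! ### Uniqueness, shifts, concatenation, splitting and the editor axiom -/

section Concatenation

variable {M : Type*} [SeqLang.Structure M] [Seq.Model M]

theorem Good.ext {n k f g : M} (h : Good n) (hf : IsSeq k (cat k n) f) (hg : IsSeq k (cat k n) g)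
    (hfg : ∀ j : M, Le nil j → Le j n → SameVal f (cat k j) g (cat k j)) : f = g :=
  h.2.2.2.2.1 k f g hf hg hfg

theorem Good.ext_nil {n f g : M} (h : Good n) (hf : IsSeq nil n f) (hg : IsSeq nil n g)
    (hfg : ∀ j : M, Le nil j → Le j n → SameVal f j g j) : f = g := by
  have hn := hf.right
  have e := hn.classJ.nil_cat
  refine h.ext (k := nil) (by rwa [e]) (by rwa [e]) fun j h0 hj => ?_
  rw [(hj.classN hn).classJ.nil_cat]
  exact hfg j h0 hj

/-- When R is single-valued, two solutions have the same values, and extensionality makes them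
equal. -/
theorem Good.existsUnique {R : M → M → Prop} {n : M} (h : Good n) (hn : ClassN n)
    (hR : ∀ j v w, Le j n → R j v → R j w → v = w) (hs : HasSeq R nil n) :
    ∃! f : M, IsSeq nil n f ∧ ∀ j : M, Le nil j → Le j n → ∃ v, Val f j v ∧ R j v := by
  obtain ⟨f, hf, hv⟩ := hs
  rw [hn.classJ.nil_cat] at hf
  have hv' : ∀ j : M, Le nil j → Le j n → ∃ v, Val f j v ∧ R j v := fun j h0 hj => by
    have := hv j h0 hj
    rwa [(hj.classN hn).classJ.nil_cat] at this
  refine ⟨f, ⟨hf, hv'⟩, fun g ⟨hg, hgv⟩ => h.ext_nil hg hf fun j h0 hj => ?_⟩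
  obtain ⟨v, hfv, hv⟩ := hv' j h0 hj
  obtain ⟨w, hgw, hw⟩ := hgv j h0 hj
  exact ⟨v, hR j w v hj hw hv ▸ hgw, hfv⟩

theorem existsUnique_const {n x : M} (h : Good n) (hn : ClassN n) (hx : ClassJ x) :
    ∃! f : M, IsSeq nil n f ∧ ∀ j : M, Le nil j → Le j n → Val f j x := by
  have := h.existsUnique hn (fun _ _ _ _ hv hw => hv.trans hw.symm) (h.1 x hx)
  simpa only [exists_eq_right] using this

theorem existsUnique_sum {n f g : M} (h : Good n) (hf : IsSeq nil n f) (hg : IsSeq nil n g) :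
    ∃! p : M, IsSeq nil n p ∧ ∀ j : M, Le nil j → Le j n →
      ∃ a b : M, Val f j a ∧ Val g j b ∧ Val p j (add a b) := by
  have hn := hf.right
  have hR : ∀ j v w : M, Le j n → (∃ a b : M, Val f j a ∧ Val g j b ∧ v = cat a b) →
      (∃ a b : M, Val f j a ∧ Val g j b ∧ w = cat a b) → v = w := by
    rintro j v w hj ⟨a, b, ha, hb, rfl⟩ ⟨a', b', ha', hb', rfl⟩
    have hjN := hj.classN hn
    rw [hf.val_unique hjN ha ha', hg.val_unique hjN hb hb']
  obtain ⟨p, ⟨hp, hpv⟩, hu⟩ := h.existsUnique hn hR (h.2.2.1 n f g hf hg (Le.refl n))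
  refine ⟨p, ⟨hp, fun j h0 hj => ?_⟩, fun q ⟨hq, hqv⟩ => hu q ⟨hq, fun j h0 hj => ?_⟩⟩
  · obtain ⟨v, hv, a, b, ha, hb, rfl⟩ := hpv j h0 hj
    exact ⟨a, b, ha, hb, hv⟩
  · obtain ⟨a, b, ha, hb, hv⟩ := hqv j h0 hj
    exact ⟨_, hv, a, b, ha, hb, rfl⟩

theorem existsUnique_diff {n f g : M} (h : Good n) (hf : IsSeq nil n f) (hg : IsSeq nil n g) :
    ∃! p : M, IsSeq nil n p ∧ ∀ j : M, Le nil j → Le j n →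
      ∃ a b c : M, Val f j a ∧ Val g j b ∧ IsTsub a b c ∧ Val p j c := by
  have hn := hf.right
  have hR : ∀ j v w : M, Le j n → (∃ a b : M, Val f j a ∧ Val g j b ∧ IsTsub a b v) →
      (∃ a b : M, Val f j a ∧ Val g j b ∧ IsTsub a b w) → v = w := by
    rintro j v w hj ⟨a, b, ha, hb, hc⟩ ⟨a', b', ha', hb', hc'⟩
    have hjN := hj.classN hn
    obtain rfl := hf.val_unique hjN ha ha'
    obtain rfl := hg.val_unique hjN hb hb'
    exact hc.unique hc'
  obtain ⟨p, ⟨hp, hpv⟩, hu⟩ := h.existsUnique hn hR (h.2.2.2.1 n f g hf hg (Le.refl n))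
  refine ⟨p, ⟨hp, fun j h0 hj => ?_⟩, fun q ⟨hq, hqv⟩ => hu q ⟨hq, fun j h0 hj => ?_⟩⟩
  · obtain ⟨v, hv, a, b, ha, hb, hc⟩ := hpv j h0 hj
    exact ⟨a, b, v, ha, hb, hc, hv⟩
  · obtain ⟨a, b, c, ha, hb, hc, hv⟩ := hqv j h0 hj
    exact ⟨c, hv, a, b, ha, hb, hc⟩

/-! ### Shifts -/

theorem IsShift.unique {k n f h h' : M} (hn : Good n) (hf : IsSeq nil n f)
    (hh : IsShift k n f h) (hh' : IsShift k n f h') : h = h' :=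
  hn.ext hh.1 hh'.1 fun j h0 hj =>
    (hh.2 j h0 hj).trans hf (hj.classN hf.right) (hh'.2 j h0 hj).symm

theorem exists_isShift {k n f : M} (h : Good n) (hk : ClassN k) (hf : IsSeq nil n f) :
    ∃ p, IsShift k n f p := by
  have hn := hf.right
  obtain ⟨p, hp, hv⟩ := h.2.1 k nil n f hk hn (by rwa [hn.classJ.nil_cat]) (Le.refl n)
  refine ⟨p, hp, fun j h0 hj => ?_⟩
  obtain ⟨v, hv, hfv⟩ := hv j h0 hj
  rw [(hj.classN hn).classJ.nil_cat] at hfv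
  exact ⟨v, hv, hfv⟩

theorem existsUnique_shift {k n f : M} (h : Good n) (hk : ClassN k) (hf : IsSeq nil n f) :
    ∃! p, IsShift k n f p := by
  obtain ⟨p, hp⟩ := exists_isShift h hk hf
  exact ⟨p, hp, fun q hq => IsShift.unique h hf hq hp⟩

/-- The shift property allows an arbitrary starting index, so it also moves sequences back to 0. -/
theorem exists_isShift_eq {k n p : M} (h : Good n) (hn : ClassN n) (hp : IsSeq k (cat k n) p) :
    ∃ f, IsSeq nil n f ∧ IsShift k n f p := by
  obtain ⟨f, hf, hv⟩ := h.2.1 nil k n p classN_nil hn hp (Le.refl n)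
  rw [hn.classJ.nil_cat] at hf
  refine ⟨f, hf, hp, fun j h0 hj => ?_⟩
  obtain ⟨v, hv, hpv⟩ := hv j h0 hj
  rw [(hj.classN hn).classJ.nil_cat] at hv
  exact ⟨v, hpv, hv⟩

/-! ### Concatenation -/

theorem add_one_eq (n : M) : add n one = app n nil := by
  simp only [add, cat_app, cat_nil]

theorem add_add_one {n m : M} (hn : ClassN n) (hm : ClassN m) :
    add (add n m) one = cat (app n nil) m := by
  rw [add_one_eq, hn.succ_cat hm]

theorem le_or_exists_eq {n j : M} (hn : ClassN n) (hj : ClassN j) :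
    Le j n ∨ ∃ i, ClassN i ∧ j = cat (app n nil) i := by
  by_cases h : j = n
  · exact .inl (h ▸ Le.refl j)
  · rcases Le.total hj hn with h' | h'
    · exact .inl h'
    · exact .inr (Lt.exists_eq hn ⟨h', Ne.symm h⟩)

/-- Writing an index of the second half as (n+1) + i removes the truncated subtraction. -/
theorem isConcat_iff {n m f g h : M} (hn : ClassN n) (hm : ClassN m) :
    IsConcat n m f g h ↔ IsSeq nil (cat (app n nil) m) h ∧
      (∃ g₁ : M, IsShift (app n nil) m g g₁ ∧ h = cat f g₁) ∧
      (∀ j : M, Le nil j → Le j n → SameVal h j f j) ∧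
      (∀ i : M, Le nil i → Le i m → SameVal h (cat (app n nil) i) g i) := by
  unfold IsConcat
  rw [add_add_one hn hm, add_one_eq]
  refine and_congr_right fun _ => and_congr_right fun _ => and_congr_right fun _ =>
    ⟨fun H i h0 hi => ?_, fun H j h1 h2 => ?_⟩
  · have hiN := hi.classN hm
    obtain ⟨i', hi', h'⟩ := H _ (le_add hiN) ((add_le_add_iff hn.succ hiN hm).2 hi)
    rwa [hi'.unique (isTsub_cat hn.succ hiN)] at h'
  · obtain ⟨i, hi, rfl⟩ := h1
    exact ⟨i, isTsub_cat hn.succ hi, H i (nil_le hi) ((add_le_add_iff hn.succ hi hm).1 h2)⟩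

theorem IsShift.isConcat {n m f g g₁ : M} (h : Good m) (hm : ClassN m)
    (hf : IsSeq nil n f) (hg : IsShift (app n nil) m g g₁) : IsConcat n m f g (cat f g₁) := by
  have hn := hf.right
  rw [isConcat_iff hn hm]
  refine ⟨h.2.2.2.2.2.1 nil n f g₁ hf hg.1, ⟨g₁, hg, rfl⟩, fun j h0 hj => ?_, fun i h0 hi => ?_⟩
  · obtain ⟨u, hu⟩ := hf.exists_val h0 hj
    exact ⟨u, hu.cat_right hg.1.classJ, hu⟩
  · obtain ⟨u, hu, hu'⟩ := hg.2 i h0 hi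
    exact ⟨u, hu.cat_left hf.classJ, hu'⟩

theorem existsUnique_concat {n m f g : M} (h : Good m) (hf : IsSeq nil n f)
    (hg : IsSeq nil m g) : ∃! p, IsConcat n m f g p := by
  obtain ⟨g₁, hg₁⟩ := exists_isShift h hf.right.succ hg
  refine ⟨_, hg₁.isConcat h hg.right hf, fun q hq => ?_⟩
  obtain ⟨-, ⟨g₂, hg₂, rfl⟩, -⟩ := (isConcat_iff hf.right hg.right).1 hq
  rw [IsShift.unique h hg hg₂ hg₁]

theorem IsConcat.isSeq {n m f g p : M} (hn : ClassN n) (hm : ClassN m)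
    (h : IsConcat n m f g p) : IsSeq nil (cat (app n nil) m) p :=
  ((isConcat_iff hn hm).1 h).1

/-- All values of both factors can be read off from p, so extensionality applies to each factor. -/
theorem IsConcat.injective {n m f g f' g' p : M} (hn : Good n) (hm : Good m)
    (hf : IsSeq nil n f) (hg : IsSeq nil m g) (hf' : IsSeq nil n f') (hg' : IsSeq nil m g')
    (h : IsConcat n m f g p) (h' : IsConcat n m f' g' p) : f = f' ∧ g = g' := by
  obtain ⟨hp, -, h1, h2⟩ := (isConcat_iff hf.right hg.right).1 h
  obtain ⟨-, -, h1', h2'⟩ := (isConcat_iff hf.right hg.right).1 h'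
  constructor
  · exact hn.ext_nil hf hf' fun j h0 hj =>
      (h1 j h0 hj).symm.trans hp (hj.classN hf.right) (h1' j h0 hj)
  · exact hm.ext_nil hg hg' fun j h0 hj =>
      (h2 j h0 hj).symm.trans hp (hf.right.succ.cat (hj.classN hg.right)) (h2' j h0 hj)

theorem exists_split {k d f : M} (h : Good d) (hk : ClassN k) (hd : ClassN d)
    (hf : IsSeq nil (cat (app k nil) d) f) :
    ∃ p q, IsSeq nil k p ∧ IsSeq nil d q ∧ IsConcat k d p q f := by
  obtain ⟨p, q₁, hp, hq₁, rfl⟩ := h.2.2.2.2.2.2 k f hk hf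
  obtain ⟨q, hq, hs⟩ := exists_isShift_eq h hd hq₁
  exact ⟨p, q, hp, hq, hs.isConcat h hd hp⟩

/-- With g₁ and h₁ the shifted copies, (fg₁)h₁ = f(g₁h₁) in J. What remains is that g₁h₁ is the
shift of gh by n+1, checked at each index according to the half it falls in. -/
theorem IsConcat.assoc {n m k f g h fg gh p : M} (hmk : Good (cat (app m nil) k))
    (hkG : Good k) (hf : IsSeq nil n f) (hg : IsSeq nil m g) (hh : IsSeq nil k h)
    (h1 : IsConcat n m f g fg) (h2 : IsConcat (cat (app n nil) m) k fg h p)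
    (h3 : IsConcat m k g h gh) : IsConcat n (cat (app m nil) k) f gh p := by
  have hn := hf.right
  have hm := hg.right
  have hk := hh.right
  have hmkN := hm.succ.cat hk
  obtain ⟨-, ⟨g₁, hg₁, rfl⟩, -⟩ := (isConcat_iff hn hm).1 h1
  obtain ⟨-, ⟨h₁, hh₁, rfl⟩, -⟩ := (isConcat_iff (hn.succ.cat hm) hk).1 h2
  obtain ⟨-, -, hv1, hv2⟩ := (isConcat_iff hm hk).1 h3
  have hadd : ∀ i : M, ClassN i → cat (app n nil) (cat (app m nil) i) =
      cat (app (cat (app n nil) m) nil) i := fun i hi => by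
    rw [← hi.classJ.cat_assoc, cat_app]
  rw [hh₁.1.classJ.cat_assoc]
  refine IsShift.isConcat hmk hmkN hf ⟨?_, fun j h0 hj => ?_⟩
  · rw [add, hadd k hk]
    exact hkG.2.2.2.2.2.1 _ _ g₁ h₁ hg₁.1 hh₁.1
  · have hjN := hj.classN hmkN
    rcases le_or_exists_eq hm hjN with hjm | ⟨i, hi, rfl⟩
    · obtain ⟨u, hu, hu'⟩ := hg₁.2 j h0 hjm
      exact SameVal.trans hg hjN ⟨u, hu.cat_right hh₁.1.classJ, hu'⟩ (hv1 j h0 hjm).symm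
    · have hik := (add_le_add_iff hm.succ hi hk).1 hj
      rw [add, hadd i hi]
      obtain ⟨u, hu, hu'⟩ := hh₁.2 i (nil_le hi) hik
      exact SameVal.trans hh hi ⟨u, hu.cat_left hg₁.1.classJ, hu'⟩ (hv2 i (nil_le hi) hik).symm

theorem existsUnique_split {n k f : M} (hnS : ClassNstar n) (hk : Lt k n)
    (hf : IsSeq nil n f) :
    ∃ d, IsTsub n (add k one) d ∧
      ∃! p : M × M, IsSeq nil k p.1 ∧ IsSeq nil d p.2 ∧ IsConcat k d p.1 p.2 f := by
  have hkS := hnS.of_le hk.1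
  obtain ⟨d, hd, rfl⟩ := hk.exists_eq hkS.1
  -- By commutativity d ≤ n, so downward closure puts the length of the second part in N⋆.
  have hdS : ClassNstar d := hnS.of_le ⟨_, hkS.1.succ, hd.comm hkS.1.succ⟩
  obtain ⟨p, q, hp, hq, hc⟩ := exists_split hdS.good hkS.1 hd hf
  refine ⟨d, by rw [add_one_eq]; exact isTsub_cat hkS.1.succ hd, (p, q), ⟨hp, hq, hc⟩, ?_⟩
  rintro ⟨p', q'⟩ ⟨hp', hq', hc'⟩
  obtain ⟨h1, h2⟩ := hc'.injective hkS.good hdS.good hp' hq' hp hq hc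
  exact Prod.ext h1 h2

theorem exists_assoc {n m k f g h : M} (hn : ClassNstar n) (hm : ClassNstar m)
    (hk : ClassNstar k) (hf : IsSeq nil n f) (hg : IsSeq nil m g) (hh : IsSeq nil k h) :
    ∃ fg gh p, IsConcat n m f g fg ∧ IsConcat (add (add n m) one) k fg h p ∧
      IsConcat m k g h gh ∧ IsConcat n (add (add m k) one) f gh p := by
  rw [add_add_one hn.1 hm.1, add_add_one hm.1 hk.1]
  obtain ⟨fg, hfg, -⟩ := existsUnique_concat hm.good hf hg
  obtain ⟨gh, hgh, -⟩ := existsUnique_concat hk.good hg hh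
  obtain ⟨p, hp, -⟩ := existsUnique_concat hk.good (hfg.isSeq hn.1 hm.1) hh
  exact ⟨fg, gh, p, hfg, hp, hgh, hfg.assoc (hm.succ.cat hk).good hk.good hf hg hh hp hgh⟩

/-- Cutting f after index k gives f = p'h. Associativity turns (p'h)g into p'(hg), and comparing
this with pq forces p' = p and hg = q. -/
theorem existsUnique_editor {n m k l f g p q c : M} (hnS : ClassNstar n) (hmS : ClassNstar m)
    (hf : IsSeq nil n f) (hg : IsSeq nil m g)
    (hp : IsSeq nil k p) (hq : IsSeq nil l q) (hc : IsConcat n m f g c)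
    (hc' : IsConcat k l p q c) (hkn : Lt k n) :
    ∃! rh : M × M, ClassNstar rh.1 ∧ IsSeq nil rh.1 rh.2 ∧
      IsConcat k rh.1 p rh.2 f ∧ IsConcat rh.1 m rh.2 g q := by
  have hkS := hnS.of_le hkn.1
  obtain ⟨r, hr, rfl⟩ := hkn.exists_eq hkS.1
  have hrS : ClassNstar r := hnS.of_le ⟨_, hkS.1.succ, hr.comm hkS.1.succ⟩
  -- The last index of c is computed from both factorizations; injectivity needs the second parts to
  -- have equal lengths.
  have hl : l = cat (app r nil) m := by
    have e := (hc.isSeq hnS.1 hmS.1).right_unique (hc'.isSeq hkS.1 hq.right)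
    refine hkS.1.succ.left_cancel hq.right (hr.succ.cat hmS.1) ?_
    rw [← e, ← hmS.1.classJ.cat_assoc, cat_app]
  obtain rfl := hl
  have hlS : ClassNstar (cat (app r nil) m) := hrS.succ.cat hmS
  obtain ⟨p', h, hp', hh, hfc⟩ := exists_split hrS.good hkS.1 hr hf
  obtain ⟨hg', hgc, -⟩ := existsUnique_concat hmS.good hh hg
  have hass := hfc.assoc hlS.good hmS.good hp' hh hg hc hgc
  obtain ⟨rfl, rfl⟩ := hass.injective hkS.good hlS.good hp' (hgc.isSeq hr hmS.1) hp hq hc'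
  refine ⟨(r, h), ⟨hrS, hh, hfc, hgc⟩, ?_⟩
  rintro ⟨r', h'⟩ ⟨hr', hh', hfc', -⟩
  obtain rfl : r' = r := hkS.1.succ.left_cancel hr'.1 hr
    ((hfc'.isSeq hkS.1 hr'.1).right_unique hf)
  exact Prod.ext rfl (hfc'.injective hkS.good hrS.good hp hh' hp hh hfc).2

end Concatenation

universe u

/-! ### Uniform definability -/

/-- The operation `t` on assignments of the variables is given by one term in all structures. -/
def TermDef (t : ∀ (M : Type u) [SeqLang.Structure M], (ℕ → M) → M) : Prop :=
  ∃ τ : SeqLang.Term ℕ, ∀ (M : Type u) [SeqLang.Structure M] (v : ℕ → M), τ.realize v = t M v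

/-- The relation `P` on assignments of the variables is given by one formula in all structures. -/
def UnifDef (P : ∀ (M : Type u) [SeqLang.Structure M], (ℕ → M) → Prop) : Prop :=
  ∃ φ : SeqLang.Formula ℕ, ∀ (M : Type u) [SeqLang.Structure M] (v : ℕ → M), φ.Realize v ↔ P M v

theorem TermDef.var (i : ℕ) : TermDef.{u} fun _ _ v => v i := ⟨.var i, fun _ _ _ => rfl⟩

theorem TermDef.nil : TermDef.{u} fun _ _ _ => SeqTh.nil := ⟨eT, fun _ _ v => realize_eT v⟩

section

variable {s t r q : ∀ (M : Type u) [SeqLang.Structure M], (ℕ → M) → M}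
  {P Q : ∀ (M : Type u) [SeqLang.Structure M], (ℕ → M) → Prop}

theorem TermDef.app (hs : TermDef s) (ht : TermDef t) :
    TermDef fun M _ v => SeqTh.app (s M v) (t M v) := by
  obtain ⟨σ, hσ⟩ := hs
  obtain ⟨τ, hτ⟩ := ht
  exact ⟨appT σ τ, fun M _ v => by rw [realize_appT, hσ, hτ]⟩

theorem TermDef.cat (hs : TermDef s) (ht : TermDef t) :
    TermDef fun M _ v => SeqTh.cat (s M v) (t M v) := by
  obtain ⟨σ, hσ⟩ := hs
  obtain ⟨τ, hτ⟩ := ht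
  exact ⟨catT σ τ, fun M _ v => by rw [realize_catT, hσ, hτ]⟩

theorem UnifDef.eq (hs : TermDef s) (ht : TermDef t) : UnifDef fun M _ v => s M v = t M v := by
  obtain ⟨σ, hσ⟩ := hs
  obtain ⟨τ, hτ⟩ := ht
  exact ⟨σ.equal τ, fun M _ v => by rw [FirstOrder.Language.Formula.realize_equal, hσ, hτ]⟩

theorem UnifDef.not (hP : UnifDef P) : UnifDef fun M _ v => ¬ P M v := by
  obtain ⟨φ, hφ⟩ := hP
  exact ⟨φ.not, fun M _ v => by rw [FirstOrder.Language.Formula.realize_not, hφ]⟩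

theorem UnifDef.ne (hs : TermDef s) (ht : TermDef t) : UnifDef fun M _ v => s M v ≠ t M v :=
  (UnifDef.eq hs ht).not

theorem UnifDef.and (hP : UnifDef P) (hQ : UnifDef Q) : UnifDef fun M _ v => P M v ∧ Q M v := by
  obtain ⟨φ, hφ⟩ := hP
  obtain ⟨ψ, hψ⟩ := hQ
  exact ⟨φ ⊓ ψ, fun M _ v => by rw [FirstOrder.Language.Formula.realize_inf, hφ, hψ]⟩

theorem UnifDef.or (hP : UnifDef P) (hQ : UnifDef Q) : UnifDef fun M _ v => P M v ∨ Q M v := by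
  obtain ⟨φ, hφ⟩ := hP
  obtain ⟨ψ, hψ⟩ := hQ
  exact ⟨φ ⊔ ψ, fun M _ v => by rw [FirstOrder.Language.Formula.realize_sup, hφ, hψ]⟩

theorem UnifDef.imp (hP : UnifDef P) (hQ : UnifDef Q) : UnifDef fun M _ v => P M v → Q M v := by
  obtain ⟨φ, hφ⟩ := hP
  obtain ⟨ψ, hψ⟩ := hQ
  exact ⟨φ.imp ψ, fun M _ v => by rw [FirstOrder.Language.Formula.realize_imp, hφ, hψ]⟩

theorem UnifDef.all {P : ∀ (M : Type u) [SeqLang.Structure M], (ℕ → M) → M → Prop}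
    (h : UnifDef fun M _ v => P M (fun i => v (i + 1)) (v 0)) :
    UnifDef fun M _ v => ∀ a, P M v a := by
  obtain ⟨φ, hφ⟩ := h
  -- De Bruijn convention: variable 0 becomes the bound variable, and i + 1 becomes the free
  -- variable i.
  refine ⟨FirstOrder.Language.Formula.iAlls Unit
    (φ.relabel fun i : ℕ => Nat.casesOn i (Sum.inr ()) Sum.inl), fun M _ v => ?_⟩
  rw [FirstOrder.Language.Formula.realize_iAlls]
  simp only [FirstOrder.Language.Formula.realize_relabel, hφ]
  exact ⟨fun H a => H fun _ => a, fun H i => H (i ())⟩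

theorem UnifDef.ex {P : ∀ (M : Type u) [SeqLang.Structure M], (ℕ → M) → M → Prop}
    (h : UnifDef fun M _ v => P M (fun i => v (i + 1)) (v 0)) :
    UnifDef fun M _ v => ∃ a, P M v a := by
  obtain ⟨φ, hφ⟩ := (UnifDef.all (P := fun M _ v a => ¬ P M v a) h.not).not
  exact ⟨φ, fun M _ v => (hφ M v).trans not_forall_not⟩

/-- Terms may be substituted for the variables of a uniformly definable relation. -/
theorem UnifDef.subst {P : ∀ (M : Type u) [SeqLang.Structure M], (ℕ → M) → Prop}
    (h : UnifDef P) {t : ℕ → ∀ (M : Type u) [SeqLang.Structure M], (ℕ → M) → M}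
    (ht : ∀ i, TermDef (t i)) : UnifDef fun M _ v => P M fun i => t i M v := by
  obtain ⟨φ, hφ⟩ := h
  choose τ hτ using ht
  refine ⟨FirstOrder.Language.BoundedFormula.subst φ τ, fun M _ v => ?_⟩
  rw [FirstOrder.Language.Formula.Realize, FirstOrder.Language.BoundedFormula.realize_subst]
  simp only [hτ]
  exact hφ M _

theorem UnifDef.subst₁ {P : ∀ (M : Type u) [SeqLang.Structure M], M → Prop}
    (h : UnifDef fun M _ v => P M (v 0)) (hs : TermDef s) : UnifDef fun M _ v => P M (s M v) :=
  h.subst (t := fun _ => s) fun _ => hs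

theorem UnifDef.subst₂ {P : ∀ (M : Type u) [SeqLang.Structure M], M → M → Prop}
    (h : UnifDef fun M _ v => P M (v 0) (v 1)) (hs : TermDef s) (ht : TermDef t) :
    UnifDef fun M _ v => P M (s M v) (t M v) :=
  h.subst (t := fun i => match i with | 0 => s | _ => t) fun i =>
    match i with | 0 => hs | _ + 1 => ht

theorem UnifDef.subst₃ {P : ∀ (M : Type u) [SeqLang.Structure M], M → M → M → Prop}
    (h : UnifDef fun M _ v => P M (v 0) (v 1) (v 2)) (hs : TermDef s) (ht : TermDef t)
    (hr : TermDef r) : UnifDef fun M _ v => P M (s M v) (t M v) (r M v) :=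
  h.subst (t := fun i => match i with | 0 => s | 1 => t | _ => r) fun i =>
    match i with | 0 => hs | 1 => ht | _ + 2 => hr

theorem UnifDef.subst₄ {P : ∀ (M : Type u) [SeqLang.Structure M], M → M → M → M → Prop}
    (h : UnifDef fun M _ v => P M (v 0) (v 1) (v 2) (v 3)) (hs : TermDef s) (ht : TermDef t)
    (hr : TermDef r) (hq : TermDef q) :
    UnifDef fun M _ v => P M (s M v) (t M v) (r M v) (q M v) :=
  h.subst (t := fun i => match i with | 0 => s | 1 => t | 2 => r | _ => q) fun i =>
    match i with | 0 => hs | 1 => ht | 2 => hr | _ + 3 => hq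

theorem UnifDef.classA (hs : TermDef s) :
    UnifDef fun M _ v => ClassA (s M v) := by
  refine UnifDef.subst₁ (P := fun M _ => ClassA) ?_ hs
  unfold ClassA
  -- The formula is read off from the syntax of the definition. Reducible transparency keeps named
  -- classes folded, so that each is handled by its own definability lemma.
  repeat' with_reducible first
    | apply UnifDef.and | apply UnifDef.eq | apply UnifDef.all | apply TermDef.var
    | apply TermDef.nil | apply TermDef.cat

theorem UnifDef.subA (hs : TermDef s) (ht : TermDef t) :
    UnifDef fun M _ v => SubA (s M v) (t M v) := by
  refine UnifDef.subst₂ (P := fun M _ => SubA) ?_ hs ht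
  unfold SubA
  repeat' with_reducible first
    | apply UnifDef.classA | apply UnifDef.and | apply UnifDef.eq | apply UnifDef.ex
    | apply TermDef.var | apply TermDef.cat

theorem UnifDef.classJ (hs : TermDef s) :
    UnifDef fun M _ v => ClassJ (s M v) := by
  refine UnifDef.subst₁ (P := fun M _ => ClassJ) ?_ hs
  unfold ClassJ
  repeat' with_reducible first
    | apply UnifDef.classA | apply UnifDef.subA | apply UnifDef.and | apply UnifDef.or
    | apply UnifDef.eq | apply UnifDef.ex | apply UnifDef.all | apply UnifDef.imp
    | apply TermDef.var | apply TermDef.cat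

theorem UnifDef.pre (hs : TermDef s) (ht : TermDef t) :
    UnifDef fun M _ v => Pre (s M v) (t M v) := by
  refine UnifDef.subst₂ (P := fun M _ => Pre) ?_ hs ht
  unfold Pre
  repeat' with_reducible first
    | apply UnifDef.classJ | apply UnifDef.and | apply UnifDef.eq | apply UnifDef.ex
    | apply TermDef.var | apply TermDef.cat

theorem UnifDef.sPre (hs : TermDef s) (ht : TermDef t) :
    UnifDef fun M _ v => SPre (s M v) (t M v) := by
  refine UnifDef.subst₂ (P := fun M _ => SPre) ?_ hs ht
  unfold SPre
  repeat' with_reducible first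
    | apply UnifDef.pre | apply UnifDef.and | apply UnifDef.ne | apply TermDef.var

theorem UnifDef.totalBelow (hs : TermDef s) :
    UnifDef fun M _ v => TotalBelow (s M v) := by
  refine UnifDef.subst₁ (P := fun M _ => TotalBelow) ?_ hs
  unfold TotalBelow
  repeat' with_reducible first
    | apply UnifDef.pre | apply UnifDef.and | apply UnifDef.or | apply UnifDef.eq
    | apply UnifDef.all | apply UnifDef.imp | apply TermDef.var

theorem UnifDef.classI (hs : TermDef s) :
    UnifDef fun M _ v => ClassI (s M v) := by
  refine UnifDef.subst₁ (P := fun M _ => ClassI) ?_ hs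
  unfold ClassI
  repeat' with_reducible first
    | apply UnifDef.classJ | apply UnifDef.pre | apply UnifDef.sPre | apply UnifDef.totalBelow
    | apply UnifDef.and | apply UnifDef.or | apply UnifDef.eq | apply UnifDef.ex
    | apply UnifDef.all | apply UnifDef.imp | apply TermDef.var | apply TermDef.nil
    | apply TermDef.app | apply TermDef.cat

theorem UnifDef.classC (hs : TermDef s) :
    UnifDef fun M _ v => ClassC (s M v) := by
  refine UnifDef.subst₁ (P := fun M _ => ClassC) ?_ hs
  unfold ClassC
  repeat' with_reducible first
    | apply UnifDef.classI | apply UnifDef.pre | apply UnifDef.and | apply UnifDef.eq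
    | apply UnifDef.all | apply UnifDef.imp | apply TermDef.var | apply TermDef.cat

theorem UnifDef.classN (hs : TermDef s) :
    UnifDef fun M _ v => ClassN (s M v) := by
  refine UnifDef.subst₁ (P := fun M _ => ClassN) ?_ hs
  unfold ClassN
  repeat' with_reducible first
    | apply UnifDef.classC | apply UnifDef.and | apply UnifDef.all | apply UnifDef.imp
    | apply TermDef.var | apply TermDef.cat

theorem UnifDef.le (hs : TermDef s) (ht : TermDef t) :
    UnifDef fun M _ v => Le (s M v) (t M v) := by
  refine UnifDef.subst₂ (P := fun M _ => Le) ?_ hs ht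
  unfold Le
  repeat' with_reducible first
    | apply UnifDef.classN | apply UnifDef.and | apply UnifDef.eq | apply UnifDef.ex
    | apply TermDef.var | apply TermDef.cat

theorem UnifDef.lt (hs : TermDef s) (ht : TermDef t) :
    UnifDef fun M _ v => Lt (s M v) (t M v) := by
  refine UnifDef.subst₂ (P := fun M _ => Lt) ?_ hs ht
  unfold Lt
  repeat' with_reducible first
    | apply UnifDef.le | apply UnifDef.and | apply UnifDef.ne | apply TermDef.var

theorem UnifDef.isTsub (hs : TermDef s) (ht : TermDef t) (hr : TermDef r) :
    UnifDef fun M _ v => IsTsub (s M v) (t M v) (r M v) := by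
  refine UnifDef.subst₃ (P := fun M _ => IsTsub) ?_ hs ht hr
  unfold IsTsub
  repeat' with_reducible first
    | apply UnifDef.classN | apply UnifDef.le | apply UnifDef.and | apply UnifDef.or
    | apply UnifDef.not | apply UnifDef.eq | apply TermDef.var | apply TermDef.nil
    | apply TermDef.cat

theorem UnifDef.isSeq (hs : TermDef s) (ht : TermDef t) (hr : TermDef r) :
    UnifDef fun M _ v => IsSeq (s M v) (t M v) (r M v) := by
  refine UnifDef.subst₃ (P := fun M _ => IsSeq) ?_ hs ht hr
  unfold IsSeq
  repeat' with_reducible first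
    | apply UnifDef.classJ | apply UnifDef.classN | apply UnifDef.le | apply UnifDef.lt
    | apply UnifDef.and | apply UnifDef.not | apply UnifDef.eq | apply UnifDef.ex
    | apply UnifDef.all | apply UnifDef.imp | apply TermDef.var | apply TermDef.nil
    | apply TermDef.app | apply TermDef.cat

theorem UnifDef.val (hs : TermDef s) (ht : TermDef t) (hr : TermDef r) :
    UnifDef fun M _ v => Val (s M v) (t M v) (r M v) := by
  refine UnifDef.subst₃ (P := fun M _ => Val) ?_ hs ht hr
  unfold Val
  repeat' with_reducible first
    | apply UnifDef.classJ | apply UnifDef.and | apply UnifDef.eq | apply UnifDef.ex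
    | apply TermDef.var | apply TermDef.app | apply TermDef.cat

theorem UnifDef.sameVal (hs : TermDef s) (ht : TermDef t) (hr : TermDef r) (hq : TermDef q) :
    UnifDef fun M _ v => SameVal (s M v) (t M v) (r M v) (q M v) := by
  refine UnifDef.subst₄ (P := fun M _ => SameVal) ?_ hs ht hr hq
  unfold SameVal
  repeat' with_reducible first
    | apply UnifDef.val | apply UnifDef.and | apply UnifDef.ex | apply TermDef.var

theorem UnifDef.hasConst (hs : TermDef s) :
    UnifDef fun M _ v => HasConst (s M v) := by
  refine UnifDef.subst₁ (P := fun M _ => HasConst) ?_ hs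
  unfold HasConst HasSeq
  repeat' with_reducible first
    | apply UnifDef.classJ | apply UnifDef.isSeq | apply UnifDef.le | apply UnifDef.val
    | apply UnifDef.and | apply UnifDef.eq | apply UnifDef.ex | apply UnifDef.all
    | apply UnifDef.imp | apply TermDef.var | apply TermDef.nil | apply TermDef.cat

theorem UnifDef.hasShift (hs : TermDef s) :
    UnifDef fun M _ v => HasShift (s M v) := by
  refine UnifDef.subst₁ (P := fun M _ => HasShift) ?_ hs
  unfold HasShift HasSeq
  repeat' with_reducible first
    | apply UnifDef.classN | apply UnifDef.isSeq | apply UnifDef.le | apply UnifDef.val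
    | apply UnifDef.and | apply UnifDef.ex | apply UnifDef.all | apply UnifDef.imp
    | apply TermDef.var | apply TermDef.nil | apply TermDef.cat

theorem UnifDef.hasSum (hs : TermDef s) :
    UnifDef fun M _ v => HasSum (s M v) := by
  refine UnifDef.subst₁ (P := fun M _ => HasSum) ?_ hs
  unfold HasSum HasSeq
  repeat' with_reducible first
    | apply UnifDef.isSeq | apply UnifDef.le | apply UnifDef.val | apply UnifDef.and
    | apply UnifDef.eq | apply UnifDef.ex | apply UnifDef.all | apply UnifDef.imp
    | apply TermDef.var | apply TermDef.nil | apply TermDef.cat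

theorem UnifDef.hasDiff (hs : TermDef s) :
    UnifDef fun M _ v => HasDiff (s M v) := by
  refine UnifDef.subst₁ (P := fun M _ => HasDiff) ?_ hs
  unfold HasDiff HasSeq
  repeat' with_reducible first
    | apply UnifDef.isSeq | apply UnifDef.le | apply UnifDef.val | apply UnifDef.isTsub
    | apply UnifDef.and | apply UnifDef.ex | apply UnifDef.all | apply UnifDef.imp
    | apply TermDef.var | apply TermDef.nil | apply TermDef.cat

theorem UnifDef.hasExt (hs : TermDef s) :
    UnifDef fun M _ v => HasExt (s M v) := by
  refine UnifDef.subst₁ (P := fun M _ => HasExt) ?_ hs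
  unfold HasExt
  repeat' with_reducible first
    | apply UnifDef.isSeq | apply UnifDef.le | apply UnifDef.sameVal | apply UnifDef.eq
    | apply UnifDef.all | apply UnifDef.imp | apply TermDef.var | apply TermDef.nil
    | apply TermDef.cat

theorem UnifDef.hasCat (hs : TermDef s) :
    UnifDef fun M _ v => HasCat (s M v) := by
  refine UnifDef.subst₁ (P := fun M _ => HasCat) ?_ hs
  unfold HasCat
  repeat' with_reducible first
    | apply UnifDef.isSeq | apply UnifDef.all | apply UnifDef.imp | apply TermDef.var
    | apply TermDef.nil | apply TermDef.app | apply TermDef.cat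

theorem UnifDef.hasSplit (hs : TermDef s) :
    UnifDef fun M _ v => HasSplit (s M v) := by
  refine UnifDef.subst₁ (P := fun M _ => HasSplit) ?_ hs
  unfold HasSplit
  repeat' with_reducible first
    | apply UnifDef.classN | apply UnifDef.isSeq | apply UnifDef.and | apply UnifDef.eq
    | apply UnifDef.ex | apply UnifDef.all | apply UnifDef.imp | apply TermDef.var
    | apply TermDef.nil | apply TermDef.app | apply TermDef.cat

theorem UnifDef.good (hs : TermDef s) :
    UnifDef fun M _ v => Good (s M v) := by
  refine UnifDef.subst₁ (P := fun M _ => Good) ?_ hs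
  unfold Good
  repeat' with_reducible first
    | apply UnifDef.hasConst | apply UnifDef.hasShift | apply UnifDef.hasSum
    | apply UnifDef.hasDiff | apply UnifDef.hasExt | apply UnifDef.hasCat | apply UnifDef.hasSplit
    | apply UnifDef.and | apply TermDef.var

theorem UnifDef.classK (hs : TermDef s) :
    UnifDef fun M _ v => ClassK (s M v) := by
  refine UnifDef.subst₁ (P := fun M _ => ClassK) ?_ hs
  unfold ClassK
  repeat' with_reducible first
    | apply UnifDef.classN | apply UnifDef.le | apply UnifDef.good | apply UnifDef.and
    | apply UnifDef.all | apply UnifDef.imp | apply TermDef.var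

theorem UnifDef.classNstar (hs : TermDef s) :
    UnifDef fun M _ v => ClassNstar (s M v) := by
  refine UnifDef.subst₁ (P := fun M _ => ClassNstar) ?_ hs
  unfold ClassNstar
  repeat' with_reducible first
    | apply UnifDef.classN | apply UnifDef.classK | apply UnifDef.and | apply UnifDef.all
    | apply UnifDef.imp | apply TermDef.var | apply TermDef.cat

end

theorem exists_formula_classNstar : ∃ φ : SeqLang.Formula (Fin 1),
    ∀ (M : Type u) [SeqLang.Structure M] (x : M), Mem φ x ↔ ClassNstar x := by
  obtain ⟨φ, hφ⟩ := UnifDef.classNstar.{u} (TermDef.var 0)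
  -- The truth of φ depends only on variable 0, so identifying all variables is harmless and leaves
  -- one free variable.
  refine ⟨φ.relabel fun _ => 0, fun M _ x => ?_⟩
  rw [Mem, FirstOrder.Language.Formula.realize_relabel, hφ]
  rfl

end SeqTh

theorem mainTheorem6 :
    ∃ Nstar : SeqLang.Formula (Fin 1),
      ∀ (M : Type*) [SeqLang.Structure M] [SeqTh.Seq.Model M],
        -- `Nstar` is a subclass of `N`, closed under `0`, `S`, `+` and downwards under `≤`
        (∀ x : M, SeqTh.Mem Nstar x → SeqTh.ClassN x) ∧
        SeqTh.Mem Nstar (SeqTh.zero : M) ∧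
        (∀ x : M, SeqTh.Mem Nstar x → SeqTh.Mem Nstar (SeqTh.succ x)) ∧
        (∀ x y : M, SeqTh.Mem Nstar x → SeqTh.Mem Nstar y → SeqTh.Mem Nstar (SeqTh.add x y)) ∧
        (∀ x y : M, SeqTh.Mem Nstar x → SeqTh.Le y x → SeqTh.Mem Nstar y) ∧
        -- constant sequences
        (∀ x n : M, SeqTh.ClassJ x → SeqTh.Mem Nstar n →
          ∃! f : M, SeqTh.IsSeq SeqTh.zero n f ∧
            ∀ j : M, SeqTh.Le SeqTh.zero j → SeqTh.Le j n → SeqTh.Val f j x) ∧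
        -- shifts
        (∀ k n f : M, SeqTh.Mem Nstar k → SeqTh.Mem Nstar n → SeqTh.IsSeq SeqTh.zero n f →
          ∃! h : M, SeqTh.IsShift k n f h) ∧
        -- pointwise sums
        (∀ n f g : M, SeqTh.Mem Nstar n →
          SeqTh.IsSeq SeqTh.zero n f → SeqTh.IsSeq SeqTh.zero n g →
          ∃! h : M, SeqTh.IsSeq SeqTh.zero n h ∧
            ∀ j : M, SeqTh.Le SeqTh.zero j → SeqTh.Le j n →
              ∃ a b : M, SeqTh.Val f j a ∧ SeqTh.Val g j b ∧ SeqTh.Val h j (SeqTh.add a b)) ∧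
        -- pointwise truncated differences
        (∀ n f g : M, SeqTh.Mem Nstar n →
          SeqTh.IsSeq SeqTh.zero n f → SeqTh.IsSeq SeqTh.zero n g →
          ∃! h : M, SeqTh.IsSeq SeqTh.zero n h ∧
            ∀ j : M, SeqTh.Le SeqTh.zero j → SeqTh.Le j n →
              ∃ a b c : M, SeqTh.Val f j a ∧ SeqTh.Val g j b ∧ SeqTh.IsTsub a b c ∧
                SeqTh.Val h j c) ∧
        -- concatenation
        (∀ n m f g : M, SeqTh.Mem Nstar n → SeqTh.Mem Nstar m →
          SeqTh.IsSeq SeqTh.zero n f → SeqTh.IsSeq SeqTh.zero m g →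
          ∃! h : M, SeqTh.IsConcat n m f g h) ∧
        -- unique splitting
        (∀ n k f : M, SeqTh.Mem Nstar n → SeqTh.Le SeqTh.zero k → SeqTh.Lt k n →
          SeqTh.IsSeq SeqTh.zero n f →
          ∃ d : M, SeqTh.IsTsub n (SeqTh.add k SeqTh.one) d ∧
            ∃! p : M × M, SeqTh.IsSeq SeqTh.zero k p.1 ∧ SeqTh.IsSeq SeqTh.zero d p.2 ∧
              SeqTh.IsConcat k d p.1 p.2 f) ∧
        -- associativity: both iterated concatenations are defined and they are equal
        (∀ n m k f g h : M, SeqTh.Mem Nstar n → SeqTh.Mem Nstar m → SeqTh.Mem Nstar k →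
          SeqTh.IsSeq SeqTh.zero n f → SeqTh.IsSeq SeqTh.zero m g → SeqTh.IsSeq SeqTh.zero k h →
          ∃ fg gh p : M,
            SeqTh.IsConcat n m f g fg ∧
            SeqTh.IsConcat (SeqTh.add (SeqTh.add n m) SeqTh.one) k fg h p ∧
            SeqTh.IsConcat m k g h gh ∧
            SeqTh.IsConcat n (SeqTh.add (SeqTh.add m k) SeqTh.one) f gh p) ∧
        -- the editor axiom
        (∀ n m k l f g p q : M, SeqTh.Mem Nstar n → SeqTh.Mem Nstar m →
          SeqTh.Mem Nstar k → SeqTh.Mem Nstar l →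
          SeqTh.IsSeq SeqTh.zero n f → SeqTh.IsSeq SeqTh.zero m g →
          SeqTh.IsSeq SeqTh.zero k p → SeqTh.IsSeq SeqTh.zero l q →
          (∃ c : M, SeqTh.IsConcat n m f g c ∧ SeqTh.IsConcat k l p q c) →
          (f = p ∧ g = q) ∨
          (∃! rh : M × M, SeqTh.Mem Nstar rh.1 ∧ SeqTh.IsSeq SeqTh.zero rh.1 rh.2 ∧
            SeqTh.IsConcat k rh.1 p rh.2 f ∧ SeqTh.IsConcat rh.1 m rh.2 g q) ∨
          (∃! rh : M × M, SeqTh.Mem Nstar rh.1 ∧ SeqTh.IsSeq SeqTh.zero rh.1 rh.2 ∧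
            SeqTh.IsConcat n rh.1 f rh.2 p ∧ SeqTh.IsConcat rh.1 l rh.2 q g)) := by
  obtain ⟨φ, hφ⟩ := SeqTh.exists_formula_classNstar
  refine ⟨φ, fun M _ _ => ?_⟩
  have hφM := hφ M
  simp only [hφM]
  refine ⟨fun x hx => hx.1, SeqTh.classNstar_nil, fun x hx => hx.succ, fun x y hx hy => hx.cat hy,
    fun x y hx h => hx.of_le h, fun x n hx hn => SeqTh.existsUnique_const hn.good hn.1 hx,
    fun k n f hk hn hf => SeqTh.existsUnique_shift hn.good hk.1 hf,
    fun n f g hn hf hg => SeqTh.existsUnique_sum hn.good hf hg,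
    fun n f g hn hf hg => SeqTh.existsUnique_diff hn.good hf hg,
    fun n m f g hn hm hf hg => SeqTh.existsUnique_concat hm.good hf hg,
    fun n k f hn _ hk hf => SeqTh.existsUnique_split hn hk hf,
    fun n m k f g h hn hm hk hf hg hh => SeqTh.exists_assoc hn hm hk hf hg hh, ?_⟩
  rintro n m k l f g p q hn hm hk hl hf hg hp hq ⟨c, hc, hc'⟩
  -- The three alternatives correspond to k = n, k < n and n < k; the last is the second with the
  -- two factorizations exchanged.
  by_cases hkn : k = n
  · subst hkn
    have e := (hc.isSeq hn.1 hm.1).right_unique (hc'.isSeq hn.1 hl.1)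
    obtain rfl := hn.1.succ.left_cancel hm.1 hl.1 e
    exact .inl (hc.injective hn.good hm.good hf hg hp hq hc')
  · rcases SeqTh.Le.total hk.1 hn.1 with h | h
    · exact .inr (.inl (SeqTh.existsUnique_editor hn hm hf hg hp hq hc hc' ⟨h, hkn⟩))
    · exact .inr (.inr (SeqTh.existsUnique_editor hk hl hp hq hf hg hc' hc ⟨h, Ne.symm hkn⟩))
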